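/- **Corollary 3.1.** Let $\Omega=[0,2\pi]^3$, $\mu,\sigma>0$, and let $H$ be the space of real $2\pi$-periodic vector fields $\varphi\in L^2(\Omega)^3$ with $\int_\Omega\varphi\,dx=0$ and $\nabla\cdot\varphi=0$, with the $L^2$ norm $|\varphi|=(\int_\Omega|\varphi(x)|^2dx)^{1/2}$. For a field $\varphi$ put $\hat\varphi(k)=(2\pi)^{-3}\int_\Omega e^{-ik\cdot x}\varphi(x)\,dx\in\mathbb C^3$, $k\in\mathbb Z^3$; $|\cdot|$ is also the Euclidean norm on $\mathbb Z^3$ and on $\mathbb C^3$. For $u_0\in H$, a solution of the unforced Navier–Stokes equations with exponential dissipation $$\frac{du}{dt}+\mu e^{2\sigma A^{1/2}}u+B(u,u)=0,\qquad u(0)=u_0,\qquad A=-\nabla^2,$$ is a function $u\in C([0,\infty);H)$ with $u(0)=u_0$ such that for every $k\in\mathbb Z^3\setminus\{0\}$ and $t>0$ $$\frac{d}{dt}\hat u(k,t)=-\mu e^{2\sigma|k|}\hat u(k,t)-\widehat{B(u,u)}(k,t),\qquad \widehat{B(u,u)}(k)=P_k\Big(i\sum_{j=1}^3k_j\,\widehat{u_ju}(k)\Big),\quad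 P_kw=w-\frac{k\cdot w}{|k|^2}k .$$ For $\kappa>3$ and $\delta>0$ let $$\beta_{\kappa,\delta}=\ln\Big((1+\delta)\,\frac{4\kappa-5}{2\kappa-5}\Big).$$ Then: 1. If $u$ is a solution with $u_0\in H$, then for every $t>0$ the field $u(t)$ coincides almost everywhere on $\mathbb R^3$ with the restriction to $\mathbb R^3$ of an entire function $\mathbb C^3\to\mathbb C^3$. 2. For all $\kappa>3$, $\delta>0$ and all $L,U,M>0$ there is a constant $\Lambda>0$ (depending on $\kappa,\delta,\mu,\sigma,L,U,M$ only) such that for every $u_0\in H$ with $|u_0|\le M$, every solution $u$ with initial value $u_0$, every $t>0$ and every $0<\varepsilon<1$, $$|\hat u(k,t)|\le \exp\Big(-\frac{\sigma(1-\varepsilon)}{\beta_{\kappa,\delta}}\,|k|\ln|k|\Big)\qquad\text{for all } k\in\mathbb Z^3 \text{ with } |k|\ge\Big(\sqrt{\tfrac{\Lambda L}{Ut}}\Big)^{\beta_{\kappa,\delta}/(\varepsilon\sigma)} .$$ 3. If $u$ is a solution with $u_0\in H$, then for every $t>0$ and every $C<\frac1{2\ln2}$, with $\tilde k=2\sigma|k|$,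 one has $|\hat u(k,t)|=o\big(e^{-C\tilde k\ln\tilde k}\big)$ as $|k|\to\infty$. -/

import Mathlib

noncomputable section

namespace ExpNSE

/-- Real space `ℝ³` with its Euclidean norm; it is also the space of velocities. -/
abbrev Space : Type := EuclideanSpace ℝ (Fin 3)

/-- The complexified space `ℂ³`. -/
abbrev CSpace : Type := EuclideanSpace ℂ (Fin 3)

/-- The period cell `Ω = [0, 2π]³`. -/
def cell : Set Space := {x | ∀ i, x i ∈ Set.Icc (0 : ℝ) (2 * Real.pi)}

/-- Lebesgue measure on the period cell. -/
def cellMeasure : MeasureTheory.Measure Space := MeasureTheory.volume.restrict cell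

/-- `f` is `2π`-periodic in each of the three variables. -/
def IsPeriodic {E : Type*} (f : Space → E) : Prop :=
  ∀ (x : Space) (i : Fin 3), f (x + EuclideanSpace.single i (2 * Real.pi)) = f x

/-- `∇ · φ = 0` in the weak sense: `∫_Ω φ · ∇q = 0` for all smooth periodic `q`. -/
def IsDivFree (φ : Space → Space) : Prop :=
  ∀ q : Space → ℝ, ContDiff ℝ (⊤ : ℕ∞) q → IsPeriodic q →
    ∫ x, fderiv ℝ q x (φ x) ∂cellMeasure = 0

/-- The phase space `H`: periodic, divergence-free, square-integrable fields with mean zero. -/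
structure MemH (φ : Space → Space) : Prop where
  periodic : IsPeriodic φ
  memLp : MeasureTheory.MemLp φ 2 cellMeasure
  mean_zero : ∫ x, φ x ∂cellMeasure = 0
  divFree : IsDivFree φ

/-- The Euclidean length `|k|` of a wave vector `k ∈ ℤ³`. -/
def waveNorm (k : Fin 3 → ℤ) : ℝ := Real.sqrt (∑ i, (k i : ℝ) ^ 2)

/-- The Fourier coefficient `(2π)⁻³ ∫_Ω e^{-i k·x} f(x) dx` of a scalar function. -/
def coeff (f : Space → ℝ) (k : Fin 3 → ℤ) : ℂ :=
  ((2 * Real.pi : ℝ) ^ 3 : ℂ)⁻¹ *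
    ∫ x, Complex.exp (-Complex.I * ∑ j, (k j : ℂ) * (x j : ℂ)) * (f x : ℂ) ∂cellMeasure

/-- The Fourier coefficient `φ̂(k) ∈ ℂ³` of a vector field. -/
def fieldCoeff (φ : Space → Space) (k : Fin 3 → ℤ) : CSpace :=
  WithLp.toLp 2 fun i => coeff (fun x => φ x i) k

/-- The Fourier coefficient at `k` of `∇ · (φ ⊗ φ)`, which is `(φ · ∇) φ` for divergence-free `φ`:
its `i`-th component is the one of `∑ j, ∂ⱼ (φⱼ φᵢ)`. -/
def convectionCoeff (φ : Space → Space) (k : Fin 3 → ℤ) : CSpace :=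
  WithLp.toLp 2 fun i => Complex.I * ∑ j, (k j : ℂ) * coeff (fun x => φ x j * φ x i) k

/-- The Fourier symbol `w ↦ w - (k·w) k / |k|²` of the (Leray) projection onto divergence-free
fields, which removes the pressure gradient. -/
def leray (k : Fin 3 → ℤ) (w : CSpace) : CSpace :=
  WithLp.toLp 2 fun i => w i - (∑ j, (k j : ℂ) * w j) / ((waveNorm k : ℂ) ^ 2) * (k i : ℂ)

/-- The Fourier coefficient at `k` of the quadratic term `B(φ, φ)`. -/
def quadCoeff (φ : Space → Space) (k : Fin 3 → ℤ) : CSpace :=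
  leray k (convectionCoeff φ k)

/-- `u` is a (weak) solution on `[0, ∞)` of the unforced problem
`du/dt + μ e^{2σ A^{1/2}} u + B(u, u) = 0`, `u(0) = u₀`, where `A = -∇²`: it is continuous in time
with values in `H`, with the `L²` norm, and the equation holds tested against every `e^{i k·x}`. -/
structure IsSolution (μ σ : ℝ) (u₀ : Space → Space) (u : ℝ → Space → Space) : Prop where
  memH : ∀ t : ℝ, 0 ≤ t → MemH (u t)
  continuous : ∀ t : ℝ, 0 ≤ t →
    Filter.Tendsto (fun s => MeasureTheory.eLpNorm (u s - u t) 2 cellMeasure)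
      (nhdsWithin t (Set.Ici 0)) (nhds 0)
  initial : u 0 =ᵐ[cellMeasure] u₀
  equation : ∀ k : Fin 3 → ℤ, k ≠ 0 → ∀ t : ℝ, 0 < t →
    HasDerivAt (fun s => fieldCoeff (u s) k)
      (-(μ * Real.exp (2 * σ * waveNorm k)) • fieldCoeff (u t) k - quadCoeff (u t) k) t

/-- The inclusion `ℝ³ ⊆ ℂ³`. -/
def complexify (x : Space) : CSpace := WithLp.toLp 2 fun i => (x i : ℂ)

/-- The field `φ` (an element of `L²`, so up to a null set) is the restriction to `ℝ³` of an entire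
function on `ℂ³`. -/
def IsEntire (φ : Space → Space) : Prop :=
  ∃ F : CSpace → CSpace, Differentiable ℂ F ∧
    ∀ᵐ x : Space, F (complexify x) = complexify (φ x)

/-- The exponent `β_{κ,δ} = ln ((1 + δ) (4κ - 5) / (2κ - 5))`. -/
def beta (κ δ : ℝ) : ℝ := Real.log ((1 + δ) * ((4 * κ - 5) / (2 * κ - 5)))

end ExpNSE

end

/-! On Fourier coefficients the mode `k` is damped at the rate `μ e^{2σ|k|}`. Over a time span `τ`,
Duhamel's formula divides both the old value and the quadratic term by this rate, a gain of
`e^{-2σ|k|}`. The quadratic term preserves the weight `e^{γ|k|}` because `|k| ≤ |k-l| + |l|`. Half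
of the gain pays for the derivative and for the summation over `k`; the rest improves the weight
from `γ` to `γ + σ`, while the radius `D` becomes `K (D/τ + D²)` (`IsCoeffSolution.smoothing_step`).

Iterating over spans `t/2, t/4, …` makes the radii grow doubly exponentially, so that `|û(k)| ≤
(Q/t)^(2^n) e^{-(n+1)σ|k|}` for every `n` (`IsCoeffSolution.norm_le_of_bound`). Choosing `2^n`
comparable to `|k|` turns this into decay like `e^{-(σ/ln 2)|k| ln|k|}` up to a factor exponential
in `|k|` (`IsCoeffSolution.norm_le`). The `ln 2` comes from the squaring of the radius in each step.

A fixed number of steps already beats any prescribed exponential, which gives the entire extension.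
The little-o claim holds because `2σC < σ/ln 2`, and the explicit bound because `ln 2 < β`. As the
threshold there tends to zero for large `t`, low modes must become small too; this, and the
dependence of the constant on `M` alone, come from the energy estimate
(`IsCoeffSolution.energy_le`). Its termwise differentiation and the cancellation of the quadratic
term are legitimate because the smoothing step, started from a merely local `L²` bound, has made the
solution regular. -/

noncomputable section

namespace ExpNSE

open MeasureTheory Filter Topology
open scoped ComplexConjugate ENNReal

/-! ### Fourier series on the period cell -/

attribute [local instance] instMeasureSpaceUnitAddCircle

theorem isProbabilityMeasure_unitAddCircle :
    IsProbabilityMeasure (volume : Measure UnitAddCircle) :=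
  inferInstanceAs (IsProbabilityMeasure AddCircle.haarAddCircle)

attribute [local instance] isProbabilityMeasure_unitAddCircle

/-- The normalized Lebesgue measure on the period cell. -/
def meanMeasure : Measure Space := ENNReal.ofReal ((2 * Real.pi) ^ 3)⁻¹ • cellMeasure

/-- The parametrization of the period cell by the unit torus. -/
def cellMap (y : UnitAddTorus (Fin 3)) : Space :=
  (2 * Real.pi) • WithLp.toLp 2 fun i => ((AddCircle.equivIoc 1 (0 : ℝ) (y i)).1 : ℝ)

theorem two_pi_smul_unitCell_ae_eq_cell :
    ((fun x : Space => (2 * Real.pi) • x) ''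
      {x : Space | ∀ i, x i ∈ Set.Ioc (0 : ℝ) (0 + 1)} : Set Space) =ᵐ[volume] cell := by
  have h2pi : (0 : ℝ) < 2 * Real.pi := by positivity
  have h := (Measure.univ_pi_Ioc_ae_eq_Icc (μ := fun _ : Fin 3 => (volume : Measure ℝ))
    (f := fun _ => (0 : ℝ)) (g := fun _ => 2 * Real.pi))
  have h2 := (PiLp.volume_preserving_ofLp (Fin 3)).quasiMeasurePreserving.preimage_ae_eq h
  have e1 : ((fun x : Space => (2 * Real.pi) • x) ''
      {x : Space | ∀ i, x i ∈ Set.Ioc (0 : ℝ) (0 + 1)} : Set Space) =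
      (WithLp.ofLp ⁻¹' (Set.univ.pi fun _ => Set.Ioc (0 : ℝ) (2 * Real.pi))) := by
    ext x
    simp only [Set.mem_image, Set.mem_ofPred_eq, Set.mem_preimage, Set.mem_pi, Set.mem_univ,
      forall_const, Set.mem_Ioc, zero_add]
    constructor
    · rintro ⟨y, hy, rfl⟩ i
      have := hy i
      simp only [PiLp.smul_apply, smul_eq_mul]
      exact ⟨by nlinarith [this.1], by nlinarith [this.2]⟩
    · intro hx
      refine ⟨(2 * Real.pi)⁻¹ • x, fun i => ?_, ?_⟩
      · have := hx i
        simp only [PiLp.smul_apply, smul_eq_mul]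
        refine ⟨by have := this.1; positivity, ?_⟩
        rw [inv_mul_le_iff₀ h2pi]; linarith [this.2]
      · rw [smul_smul, mul_inv_cancel₀ h2pi.ne', one_smul]
  have e2 : cell = (WithLp.ofLp ⁻¹' (Set.Icc (fun _ : Fin 3 => (0 : ℝ))
      (fun _ => 2 * Real.pi)) : Set Space) := by
    ext x
    simp only [cell, Set.mem_ofPred_eq, Set.mem_preimage, Set.mem_Icc, Pi.le_def]
    exact ⟨fun h => ⟨fun i => (h i).1, fun i => (h i).2⟩, fun h i => ⟨h.1 i, h.2 i⟩⟩
  rw [e1, e2]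
  exact h2

theorem measurePreserving_cellMap : MeasurePreserving cellMap volume meanMeasure := by
  have h2pi : (0 : ℝ) < 2 * Real.pi := by positivity
  have h1 := UnitAddTorus.measurePreserving_equivPiIoc (d := Fin 3) (fun _ => (0 : ℝ))
  have hS : MeasurableSet {x : Fin 3 → ℝ | ∀ i, x i ∈ Set.Ioc (0 : ℝ) (0 + 1)} :=
    MeasurableSet.univ_pi' (fun i => measurableSet_Ioc)
  have h2 : MeasurePreserving (Subtype.val : {x : Fin 3 → ℝ // ∀ i, x i ∈ Set.Ioc (0 : ℝ) (0 + 1)}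
      → (Fin 3 → ℝ)) (Measure.comap Subtype.val volume)
      (volume.restrict {x : Fin 3 → ℝ | ∀ i, x i ∈ Set.Ioc (0 : ℝ) (0 + 1)}) :=
    ⟨measurable_subtype_coe, map_comap_subtype_coe hS volume⟩
  have hS' : MeasurableSet {x : Space | ∀ i, x i ∈ Set.Ioc (0 : ℝ) (0 + 1)} :=
    (PiLp.volume_preserving_ofLp (Fin 3)).measurable hS
  have h3 := (PiLp.volume_preserving_toLp (Fin 3)).restrict_preimage hS'
  have h4 : MeasurePreserving (fun x : Space => (2 * Real.pi) • x)
      (volume.restrict {x : Space | ∀ i, x i ∈ Set.Ioc (0 : ℝ) (0 + 1)}) meanMeasure := by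
    refine ⟨measurable_const_smul _, ?_⟩
    have hinj : Function.Injective (fun x : Space => (2 * Real.pi) • x) :=
      smul_right_injective _ h2pi.ne'
    have hemb : MeasurableEmbedding (fun x : Space => (2 * Real.pi) • x) :=
      (Homeomorph.smulOfNeZero (2 * Real.pi) h2pi.ne').measurableEmbedding
    have := hemb.restrict_map volume
      ((fun x : Space => (2 * Real.pi) • x) '' {x : Space | ∀ i, x i ∈ Set.Ioc (0 : ℝ) (0 + 1)})
    rw [Set.preimage_image_eq _ hinj] at this
    rw [← this, Measure.map_addHaar_smul _ h2pi.ne', Measure.restrict_smul,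
      Measure.restrict_congr_set two_pi_smul_unitCell_ae_eq_cell, meanMeasure, cellMeasure]
    simp only [finrank_euclideanSpace, Fintype.card_fin]
    rw [abs_of_pos (by positivity)]
  exact h4.comp (h3.comp (h2.comp h1))

instance : IsProbabilityMeasure meanMeasure := by
  exact ⟨by rw [← measurePreserving_cellMap.measure_preimage MeasurableSet.univ.nullMeasurableSet,
    Set.preimage_univ, measure_univ]⟩

/-- The exponential `e^{i k·x}`. -/
def character (k : Fin 3 → ℤ) (x : Space) : ℂ :=
  Complex.exp (Complex.I * ∑ j, (k j : ℂ) * (x j : ℂ))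

theorem mFourier_eq_character (k : Fin 3 → ℤ) (y : UnitAddTorus (Fin 3)) :
    UnitAddTorus.mFourier k y = character k (cellMap y) := by
  have h : ∀ i, y i = (((AddCircle.equivIoc 1 (0 : ℝ) (y i)).1 : ℝ) : UnitAddCircle) := fun i =>
    AddCircle.coe_equivIoc.symm
  simp only [UnitAddTorus.mFourier, ContinuousMap.coe_mk, character]
  rw [Finset.mul_sum, Complex.exp_sum]
  refine Finset.prod_congr rfl fun i _ => ?_
  conv_lhs => rw [h i]
  rw [fourier_coe_apply]
  simp only [cellMap, PiLp.smul_apply, smul_eq_mul]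
  congr 1
  push_cast
  ring

theorem continuous_character (k : Fin 3 → ℤ) : Continuous (character k) := by
  unfold character
  fun_prop

theorem norm_character (k : Fin 3 → ℤ) (x : Space) : ‖character k x‖ = 1 := by
  have : Complex.I * ∑ j, (k j : ℂ) * (x j : ℂ) = ((∑ j, (k j : ℝ) * x j : ℝ) : ℂ) * Complex.I := by
    push_cast; ring
  rw [character, this, Complex.norm_exp_ofReal_mul_I]

theorem character_add (k l : Fin 3 → ℤ) (x : Space) :
    character (k + l) x = character k x * character l x := by
  simp only [character, ← Complex.exp_add, ← mul_add, ← Finset.sum_add_distrib, Pi.add_apply]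
  congr 2
  refine Finset.sum_congr rfl fun j _ => ?_
  push_cast; ring

theorem conj_character (k : Fin 3 → ℤ) (x : Space) : conj (character k x) = character (-k) x := by
  simp only [character, ← Complex.exp_conj, map_mul, map_sum, Complex.conj_I, Complex.conj_ofReal,
    Pi.neg_apply]
  congr 1
  simp [Finset.sum_neg_distrib]

/-- The Fourier coefficient of a complex-valued function on the period cell. -/
def cCoeff (f : Space → ℂ) (k : Fin 3 → ℤ) : ℂ := ∫ x, character (-k) x * f x ∂meanMeasure

theorem mFourierCoeff_comp_cellMap {f : Space → ℂ} (hf : AEStronglyMeasurable f meanMeasure)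
    (k : Fin 3 → ℤ) : UnitAddTorus.mFourierCoeff (f ∘ cellMap) k = cCoeff f k := by
  have hm : AEStronglyMeasurable (fun x => character (-k) x * f x) meanMeasure :=
    (continuous_character _).aestronglyMeasurable.mul hf
  rw [cCoeff, ← measurePreserving_cellMap.map_eq, integral_map
    measurePreserving_cellMap.measurable.aemeasurable
    (by rw [measurePreserving_cellMap.map_eq]; exact hm)]
  simp only [UnitAddTorus.mFourierCoeff, mFourier_eq_character, smul_eq_mul, Function.comp_apply]

theorem integral_comp_cellMap {f : Space → ℂ} (hf : AEStronglyMeasurable f meanMeasure) :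
    ∫ y, f (cellMap y) = ∫ x, f x ∂meanMeasure := by
  rw [← measurePreserving_cellMap.map_eq, integral_map
    measurePreserving_cellMap.measurable.aemeasurable
    (by rw [measurePreserving_cellMap.map_eq]; exact hf)]

/-- Parseval's identity on the period cell. -/
theorem hasSum_conj_cCoeff_mul {f g : Space → ℂ} (hf : MemLp f 2 meanMeasure)
    (hg : MemLp g 2 meanMeasure) :
    HasSum (fun k => conj (cCoeff f k) * cCoeff g k) (∫ x, conj (f x) * g x ∂meanMeasure) := by
  have hf' := hf.comp_measurePreserving measurePreserving_cellMap
  have hg' := hg.comp_measurePreserving measurePreserving_cellMap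
  have h := UnitAddTorus.hasSum_prod_mFourierCoeff (d := Fin 3) hf'.toLp hg'.toLp
  have key : ∀ {f : Space → ℂ} (hf : MemLp (f ∘ cellMap) 2 volume)
      (_ : AEStronglyMeasurable f meanMeasure) (k : Fin 3 → ℤ),
      UnitAddTorus.mFourierCoeff hf.toLp k = cCoeff f k := by
    intro f hf hfm k
    rw [← mFourierCoeff_comp_cellMap hfm]
    refine integral_congr_ae ?_
    filter_upwards [hf.coeFn_toLp] with y hy
    rw [hy]
  simp only [key hf' hf.1, key hg' hg.1] at h
  convert h using 1
  rw [← integral_comp_cellMap (f := fun x => conj (f x) * g x)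
    ((RCLike.continuous_conj.comp_aestronglyMeasurable hf.1).mul hg.1)]
  refine integral_congr_ae ?_
  filter_upwards [hf'.coeFn_toLp, hg'.coeFn_toLp] with y h1 h2
  rw [h1, h2]; rfl

theorem hasSum_norm_cCoeff_sq {f : Space → ℂ} (hf : MemLp f 2 meanMeasure) :
    HasSum (fun k => ‖cCoeff f k‖ ^ 2) (∫ x, ‖f x‖ ^ 2 ∂meanMeasure) := by
  have h := hasSum_conj_cCoeff_mul hf hf
  have e1 : (fun k => conj (cCoeff f k) * cCoeff f k) = fun k => ((‖cCoeff f k‖ ^ 2 : ℝ) : ℂ) := by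
    funext k; rw [Complex.conj_mul']; push_cast; rfl
  have e2 : ∫ x, conj (f x) * f x ∂meanMeasure = ((∫ x, ‖f x‖ ^ 2 ∂meanMeasure : ℝ) : ℂ) := by
    rw [← integral_complex_ofReal]
    refine integral_congr_ae (.of_forall fun x => ?_)
    simp only [Complex.conj_mul']; push_cast; rfl
  rw [e1, e2] at h
  exact Complex.hasSum_ofReal.mp h

/-- The Fourier coefficients of a product are given by the convolution. -/
theorem hasSum_cCoeff_mul {f g : Space → ℂ} (hf : MemLp f 2 meanMeasure)
    (hg : MemLp g 2 meanMeasure) (k : Fin 3 → ℤ) :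
    HasSum (fun l => cCoeff f (k - l) * cCoeff g l) (cCoeff (fun x => f x * g x) k) := by
  -- Parseval for the pair `e^{ik·x} conj f` and `g`: the conjugated coefficient of the first
  -- function at `l` is the coefficient of `f` at `k - l`.
  have hF : MemLp (fun x => character k x * conj (f x)) 2 meanMeasure := by
    refine hf.of_le ((continuous_character k).aestronglyMeasurable.mul
      (RCLike.continuous_conj.comp_aestronglyMeasurable hf.1)) (.of_forall fun x => ?_)
    simp [norm_character]
  have h := hasSum_conj_cCoeff_mul hF hg
  convert h using 1
  · funext l
    congr 1
    rw [cCoeff, cCoeff, ← integral_conj]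
    refine integral_congr_ae (.of_forall fun x => ?_)
    simp only [map_mul, Complex.conj_conj, conj_character, neg_neg]
    rw [← mul_assoc, ← character_add]
    congr 2
    abel
  · rw [cCoeff]
    refine integral_congr_ae (.of_forall fun x => ?_)
    simp only [map_mul, Complex.conj_conj, conj_character]
    ring

/-! ### Fourier coefficients of the fields and of solutions -/

/-- Sequences of Fourier coefficients of vector fields. -/
abbrev CoeffSeq : Type := (Fin 3 → ℤ) → CSpace

/-- The Fourier coefficients of the convective term, expressed by the Fourier coefficients of the
field. -/
def seqConvection (c : CoeffSeq) (k : Fin 3 → ℤ) : CSpace :=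
  WithLp.toLp 2 fun i => Complex.I * ∑ j, (k j : ℂ) * ∑' l, c (k - l) j * c l i

/-- The Fourier coefficients of the quadratic term, expressed by the Fourier coefficients of the
field. -/
def seqQuad (c : CoeffSeq) (k : Fin 3 → ℤ) : CSpace := leray k (seqConvection c k)

theorem integral_meanMeasure {E : Type*} [NormedAddCommGroup E] [NormedSpace ℝ E] (f : Space → E) :
    ∫ x, f x ∂meanMeasure = ((2 * Real.pi) ^ 3)⁻¹ • ∫ x, f x ∂cellMeasure := by
  rw [meanMeasure, integral_smul_measure, ENNReal.toReal_ofReal (by positivity)]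

theorem memLp_meanMeasure {E : Type*} [NormedAddCommGroup E] {p : ℝ≥0∞} {f : Space → E}
    (hf : MemLp f p cellMeasure) : MemLp f p meanMeasure :=
  hf.smul_measure ENNReal.ofReal_ne_top

theorem meanMeasure_le : meanMeasure ≤ cellMeasure := by
  have h : ENNReal.ofReal ((2 * Real.pi) ^ 3)⁻¹ ≤ 1 := by
    rw [ENNReal.ofReal_le_one]
    refine inv_le_one_of_one_le₀ (one_le_pow₀ ?_)
    linarith [Real.pi_gt_three]
  intro s
  rw [meanMeasure, Measure.smul_apply, smul_eq_mul]
  calc _ ≤ 1 * cellMeasure s := by gcongr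
    _ = _ := one_mul _

theorem coeff_eq_cCoeff (f : Space → ℝ) (k : Fin 3 → ℤ) :
    coeff f k = cCoeff (fun x => (f x : ℂ)) k := by
  rw [coeff, cCoeff, integral_meanMeasure, Complex.real_smul]
  congr 1
  · push_cast; rfl
  · refine integral_congr_ae (.of_forall fun x => ?_)
    simp only [character, Pi.neg_apply]
    congr 2
    push_cast
    simp [Finset.sum_neg_distrib]

theorem coeff_neg (f : Space → ℝ) (k : Fin 3 → ℤ) : coeff f (-k) = conj (coeff f k) := by
  rw [coeff_eq_cCoeff, coeff_eq_cCoeff, cCoeff, cCoeff, ← integral_conj]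
  refine integral_congr_ae (.of_forall fun x => ?_)
  simp only [map_mul, conj_character, Complex.conj_ofReal]

theorem memLp_ofReal_component {φ : Space → Space} (h : MemLp φ 2 cellMeasure) (i : Fin 3) :
    MemLp (fun x => ((φ x i : ℝ) : ℂ)) 2 meanMeasure :=
  ((memLp_meanMeasure h).eval_piLp i).ofReal

theorem quadCoeff_eq {φ : Space → Space} (h : MemLp φ 2 cellMeasure) (k : Fin 3 → ℤ) :
    quadCoeff φ k = seqQuad (fieldCoeff φ) k := by
  rw [quadCoeff, seqQuad]
  congr 1
  ext i
  simp only [convectionCoeff, seqConvection, fieldCoeff]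
  congr 1
  refine Finset.sum_congr rfl fun j _ => ?_
  congr 1
  rw [coeff_eq_cCoeff]
  push_cast
  rw [← (hasSum_cCoeff_mul (memLp_ofReal_component h j) (memLp_ofReal_component h i) k).tsum_eq]
  simp only [coeff_eq_cCoeff]

theorem integral_norm_sq_eq {α E : Type*} [MeasurableSpace α] {ν : Measure α}
    [NormedAddCommGroup E] {f : α → E} (hf : MemLp f 2 ν) :
    ∫ x, ‖f x‖ ^ 2 ∂ν = (eLpNorm f 2 ν).toReal ^ 2 := by
  have h0 : 0 ≤ ∫ x, ‖f x‖ ^ 2 ∂ν := integral_nonneg fun x => by positivity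
  rw [hf.eLpNorm_eq_integral_rpow_norm two_ne_zero ENNReal.ofNat_ne_top]
  simp only [ENNReal.toReal_ofNat, Real.rpow_ofNat]
  rw [ENNReal.toReal_ofReal (by positivity), ← Real.rpow_natCast, ← Real.rpow_mul h0]
  norm_num

theorem hasSum_norm_fieldCoeff_sq {φ : Space → Space} (h : MemLp φ 2 cellMeasure) :
    HasSum (fun k => ‖fieldCoeff φ k‖ ^ 2) (∫ x, ‖φ x‖ ^ 2 ∂meanMeasure) := by
  have h1 := hasSum_sum (s := Finset.univ)
    fun i _ => hasSum_norm_cCoeff_sq (memLp_ofReal_component h i)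
  have e1 : ∫ x, ‖φ x‖ ^ 2 ∂meanMeasure = ∑ i, ∫ x, ‖((φ x i : ℝ) : ℂ)‖ ^ 2 ∂meanMeasure := by
    rw [← integral_finsetSum]
    · refine integral_congr_ae (.of_forall fun x => ?_)
      simp only [EuclideanSpace.norm_sq_eq, Complex.norm_real]
    · intro i _
      simpa using (memLp_ofReal_component h i).integrable_norm_pow two_ne_zero
  rw [e1]
  convert h1 using 2 with k
  simp only [EuclideanSpace.norm_sq_eq, fieldCoeff, coeff_eq_cCoeff]

/-- Parseval holds for the normalized measure; passing to Lebesgue measure on the cell only enlarges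
the norm, since `(2π)⁻³ ≤ 1`. -/
theorem tsum_norm_fieldCoeff_sq_le {φ : Space → Space} (h : MemLp φ 2 cellMeasure) :
    ∑' k, ‖fieldCoeff φ k‖ ^ 2 ≤ (eLpNorm φ 2 cellMeasure).toReal ^ 2 := by
  rw [(hasSum_norm_fieldCoeff_sq h).tsum_eq, integral_norm_sq_eq (memLp_meanMeasure h)]
  exact pow_le_pow_left₀ ENNReal.toReal_nonneg
    (ENNReal.toReal_mono h.eLpNorm_ne_top (eLpNorm_mono_measure φ meanMeasure_le)) 2

theorem fieldCoeff_zero {φ : Space → Space} (h : MemH φ) : fieldCoeff φ 0 = 0 := by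
  have hi : Integrable φ meanMeasure := (memLp_meanMeasure h.memLp).integrable one_le_two
  ext i
  simp only [fieldCoeff, coeff_eq_cCoeff, cCoeff, character, neg_zero, Pi.zero_apply,
    Int.cast_zero, zero_mul, Finset.sum_const_zero, mul_zero, Complex.exp_zero, one_mul,
    PiLp.zero_apply]
  rw [integral_complex_ofReal, ← eval_integral_piLp fun i => hi.eval_piLp i, integral_meanMeasure,
    h.mean_zero]
  simp

theorem fieldCoeff_neg (φ : Space → Space) (k : Fin 3 → ℤ) (i : Fin 3) :
    fieldCoeff φ (-k) i = conj (fieldCoeff φ k i) := by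
  simp only [fieldCoeff, coeff_neg]

/-- The weak divergence condition is tested with `cos (k·x)` and `sin (k·x)`, the real and imaginary
parts of the character. -/
theorem sum_mul_fieldCoeff {φ : Space → Space} (h : MemH φ) (k : Fin 3 → ℤ) :
    ∑ j, (k j : ℂ) * fieldCoeff φ k j = 0 := by
  set ℓ : Space →L[ℝ] ℝ := ∑ j, (k j : ℝ) • EuclideanSpace.proj j with hℓ
  have hℓa : ∀ x, ℓ x = ∑ j, (k j : ℝ) * x j := fun x => by
    simp [hℓ]
  have hper : ∀ x i, ℓ (x + EuclideanSpace.single i (2 * Real.pi)) =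
      ℓ x + k i * (2 * Real.pi) := fun x i => by
    rw [map_add]
    congr 1
    rw [hℓa, Finset.sum_eq_single i]
    · simp
    · intro j _ hj; simp [hj]
    · simp
  have hcos := h.divFree (fun x => Real.cos (ℓ x)) (Real.contDiff_cos.comp ℓ.contDiff)
    fun x i => by simp only [hper, Real.cos_add_int_mul_two_pi]
  have hsin := h.divFree (fun x => Real.sin (ℓ x)) (Real.contDiff_sin.comp ℓ.contDiff)
    fun x i => by simp only [hper, Real.sin_add_int_mul_two_pi]
  have e1 : ∀ x, fderiv ℝ (fun x => Real.cos (ℓ x)) x (φ x) = -(Real.sin (ℓ x) * ℓ (φ x)) :=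
    fun x => by rw [(ℓ.hasFDerivAt.cos).fderiv]; simp
  have e2 : ∀ x, fderiv ℝ (fun x => Real.sin (ℓ x)) x (φ x) = Real.cos (ℓ x) * ℓ (φ x) :=
    fun x => by rw [(ℓ.hasFDerivAt.sin).fderiv]; simp
  simp only [e1, e2, integral_neg, neg_eq_zero] at hcos hsin
  have hi : Integrable φ meanMeasure := (memLp_meanMeasure h.memLp).integrable one_le_two
  have hLi : Integrable (fun x => ℓ (φ x)) meanMeasure := ℓ.integrable_comp hi
  have hc : Integrable (fun x => ((Real.cos (ℓ x) * ℓ (φ x) : ℝ) : ℂ)) meanMeasure :=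
    (hLi.bdd_mul (c := 1) (by fun_prop) (.of_forall fun x => Real.abs_cos_le_one _)).ofReal
  have hs : Integrable (fun x => ((Real.sin (ℓ x) * ℓ (φ x) : ℝ) : ℂ)) meanMeasure :=
    (hLi.bdd_mul (c := 1) (by fun_prop) (.of_forall fun x => Real.abs_sin_le_one _)).ofReal
  have hint : ∀ j, Integrable (fun x => (k j : ℂ) * (character (-k) x * ((φ x j : ℝ) : ℂ)))
      meanMeasure := fun j =>
    (((hi.eval_piLp j).ofReal).bdd_mul (c := 1) (continuous_character _).aestronglyMeasurable
      (.of_forall fun x => (norm_character _ x).le)).const_mul _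
  calc ∑ j, (k j : ℂ) * fieldCoeff φ k j
      = ∫ x, ∑ j, (k j : ℂ) * (character (-k) x * ((φ x j : ℝ) : ℂ)) ∂meanMeasure := by
        rw [integral_finsetSum _ fun j _ => hint j]
        refine Finset.sum_congr rfl fun j _ => ?_
        rw [integral_const_mul]
        simp only [fieldCoeff, coeff_eq_cCoeff, cCoeff]
    _ = ∫ x, (((Real.cos (ℓ x) * ℓ (φ x) : ℝ) : ℂ) -
          Complex.I * ((Real.sin (ℓ x) * ℓ (φ x) : ℝ) : ℂ)) ∂meanMeasure := by
        refine integral_congr_ae (.of_forall fun x => ?_)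
        have hch : character (-k) x = Real.cos (ℓ x) - Complex.I * Real.sin (ℓ x) := by
          have : Complex.I * ∑ j, (((-k) j : ℤ) : ℂ) * (x j : ℂ) = ((-ℓ x : ℝ) : ℂ) * Complex.I := by
            rw [hℓa]; push_cast; simp [Finset.sum_neg_distrib]; ring
          rw [character, this, Complex.exp_mul_I]
          push_cast
          rw [Complex.cos_neg, Complex.sin_neg]; ring
        have hl : ((ℓ (φ x) : ℝ) : ℂ) = ∑ j, (k j : ℂ) * ((φ x j : ℝ) : ℂ) := by
          rw [hℓa]; push_cast; rfl
        simp only [hch]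
        push_cast
        rw [hl, Finset.mul_sum, Finset.mul_sum, Finset.mul_sum, ← Finset.sum_sub_distrib]
        exact Finset.sum_congr rfl fun j _ => by ring
    _ = 0 := by
        rw [integral_sub hc (hs.const_mul _), integral_const_mul, integral_complex_ofReal,
          integral_complex_ofReal, integral_meanMeasure, integral_meanMeasure, hcos, hsin]
        simp

/-- The properties of the Fourier coefficients `a t k` of a solution on which the estimates depend;
`M` bounds the initial value. -/
structure IsCoeffSolution (μ σ M : ℝ) (a : ℝ → CoeffSeq) : Prop where
  zero : ∀ t, 0 ≤ t → a t 0 = 0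
  neg : ∀ t, 0 ≤ t → ∀ k i, a t (-k) i = conj (a t k i)
  divFree : ∀ t, 0 ≤ t → ∀ k, ∑ j, (k j : ℂ) * a t k j = 0
  summable : ∀ t, 0 ≤ t → Summable fun k => ‖a t k‖ ^ 2
  bounded : ∀ T, ∃ B, ∀ t, 0 ≤ t → t ≤ T → ∑' k, ‖a t k‖ ^ 2 ≤ B ^ 2
  initial : ∀ η, 0 < η → ∀ᶠ t in 𝓝[>] (0 : ℝ), ∑' k, ‖a t k‖ ^ 2 ≤ (M + η) ^ 2
  equation : ∀ k, k ≠ 0 → ∀ t, 0 < t → HasDerivAt (fun s => a s k)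
    (-(μ * Real.exp (2 * σ * waveNorm k)) • a t k - seqQuad (a t) k) t

/-- Of the continuity in `L²` only two consequences are kept: boundedness on compact time intervals,
and an upper bound near time zero by anything larger than `M`. -/
theorem IsSolution.isCoeffSolution {μ σ M : ℝ} {u₀ : Space → Space} {u : ℝ → Space → Space}
    (hM : 0 ≤ M) (hu₀ : eLpNorm u₀ 2 cellMeasure ≤ ENNReal.ofReal M) (h : IsSolution μ σ u₀ u) :
    IsCoeffSolution μ σ M fun t => fieldCoeff (u t) := by
  set N : ℝ → ℝ := fun t => (eLpNorm (u t) 2 cellMeasure).toReal with hN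
  have hfin : ∀ t, 0 ≤ t → eLpNorm (u t) 2 cellMeasure ≠ ∞ := fun t ht =>
    (h.memH t ht).memLp.eLpNorm_ne_top
  have hNle : ∀ s t, 0 ≤ s → 0 ≤ t →
      N s ≤ N t + (eLpNorm (u s - u t) 2 cellMeasure).toReal := fun s t hs ht => by
    have hd := (h.memH s hs).memLp.sub (h.memH t ht).memLp
    have := eLpNorm_add_le (h.memH t ht).memLp.1 hd.1 one_le_two
    rw [add_sub_cancel] at this
    rw [hN]
    simp only
    rw [← ENNReal.toReal_add (hfin t ht) hd.eLpNorm_ne_top]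
    exact ENNReal.toReal_mono (ENNReal.add_ne_top.mpr ⟨hfin t ht, hd.eLpNorm_ne_top⟩) this
  have hcont : ContinuousOn N (Set.Ici 0) := by
    intro t ht
    have h0 := (ENNReal.tendsto_toReal ENNReal.zero_ne_top).comp (h.continuous t ht)
    rw [ContinuousWithinAt, tendsto_iff_dist_tendsto_zero]
    refine squeeze_zero' (.of_forall fun _ => dist_nonneg) ?_ h0
    filter_upwards [self_mem_nhdsWithin] with s hs
    have h1 := hNle s t hs ht
    have h2 := hNle t s ht hs
    rw [eLpNorm_sub_comm] at h2
    rw [Real.dist_eq, abs_le, Function.comp_apply]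
    constructor <;> linarith
  have hN0 : N 0 ≤ M := by
    rw [hN]
    simp only
    rw [eLpNorm_congr_ae h.initial]
    exact ENNReal.toReal_le_of_le_ofReal hM hu₀
  refine ⟨fun t ht => fieldCoeff_zero (h.memH t ht), fun t ht k i => fieldCoeff_neg _ _ _,
    fun t ht k => sum_mul_fieldCoeff (h.memH t ht) k,
    fun t ht => (hasSum_norm_fieldCoeff_sq (h.memH t ht).memLp).summable, ?_, ?_, ?_⟩
  · intro T
    obtain ⟨B, hB⟩ := (isCompact_Icc (a := (0 : ℝ)) (b := T)).exists_bound_of_continuousOn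
      (hcont.mono Set.Icc_subset_Ici_self)
    refine ⟨B, fun t ht htT => (tsum_norm_fieldCoeff_sq_le (h.memH t ht).memLp).trans ?_⟩
    have := hB t ⟨ht, htT⟩
    rw [Real.norm_eq_abs, abs_of_nonneg ENNReal.toReal_nonneg] at this
    exact pow_le_pow_left₀ ENNReal.toReal_nonneg this 2
  · intro η hη
    have h1 : ∀ᶠ t in 𝓝[≥] (0 : ℝ), N t < M + η :=
      (hcont 0 Set.self_mem_Ici).eventually (gt_mem_nhds (by linarith))
    filter_upwards [nhdsWithin_mono 0 Set.Ioi_subset_Ici_self h1, self_mem_nhdsWithin] with t ht ht0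
    exact (tsum_norm_fieldCoeff_sq_le (h.memH t (le_of_lt ht0)).memLp).trans
      (pow_le_pow_left₀ ENNReal.toReal_nonneg ht.le 2)
  · intro k hk t ht
    rw [← quadCoeff_eq (h.memH t ht.le).memLp]
    exact h.equation k hk t ht

/-! ### Wave vectors -/

theorem waveNorm_eq_norm (k : Fin 3 → ℤ) :
    waveNorm k = ‖(WithLp.toLp 2 fun i => ((k i : ℝ)) : Space)‖ := by
  simp [waveNorm, EuclideanSpace.norm_eq]

theorem waveNorm_eq_norm_complex (k : Fin 3 → ℤ) :
    waveNorm k = ‖(WithLp.toLp 2 fun i => ((k i : ℂ)) : CSpace)‖ := by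
  simp [waveNorm, EuclideanSpace.norm_eq]

theorem waveNorm_nonneg (k : Fin 3 → ℤ) : 0 ≤ waveNorm k := Real.sqrt_nonneg _

theorem waveNorm_zero : waveNorm 0 = 0 := by simp [waveNorm]

theorem waveNorm_le_add (k l : Fin 3 → ℤ) : waveNorm k ≤ waveNorm (k - l) + waveNorm l := by
  simp only [waveNorm_eq_norm]
  have e : (WithLp.toLp 2 fun i => ((k i : ℝ)) : Space) =
      (WithLp.toLp 2 fun i => (((k - l) i : ℤ) : ℝ)) + WithLp.toLp 2 fun i => ((l i : ℝ)) := by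
    ext i
    simp
  rw [e]
  exact norm_add_le _ _

theorem abs_le_waveNorm (k : Fin 3 → ℤ) (j : Fin 3) : |(k j : ℝ)| ≤ waveNorm k := by
  rw [waveNorm, ← Real.sqrt_sq_eq_abs]
  exact Real.sqrt_le_sqrt (Finset.single_le_sum (f := fun i => (k i : ℝ) ^ 2)
    (fun i _ => sq_nonneg _) (Finset.mem_univ j))

theorem one_le_waveNorm {k : Fin 3 → ℤ} (hk : k ≠ 0) : 1 ≤ waveNorm k := by
  obtain ⟨j, hj⟩ := Function.ne_iff.mp hk
  refine le_trans ?_ (abs_le_waveNorm k j)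
  rw [← Int.cast_abs]
  exact_mod_cast Int.one_le_abs hj

/-- Since `3|k| ≥ |k₀| + |k₁| + |k₂|`, a product of three geometric series is a majorant. -/
theorem summable_exp_neg_waveNorm {c : ℝ} (hc : 0 < c) :
    Summable fun k : Fin 3 → ℤ => Real.exp (-(c * waveNorm k)) := by
  have h1 : Summable fun m : ℤ => Real.exp (-(c / 3 * |(m : ℝ)|)) := by
    have hn : Summable fun n : ℕ => Real.exp (-(c / 3 * n)) := by
      have := Real.summable_exp_nat_mul_iff.mpr (neg_lt_zero.mpr (show 0 < c / 3 by positivity))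
      refine this.congr fun n => ?_
      congr 1; ring
    refine Summable.of_nat_of_neg ?_ ?_ <;> simpa using hn
  have h2 := (h1.mul_of_nonneg (h1.mul_of_nonneg h1 (fun _ => (Real.exp_pos _).le)
    (fun _ => (Real.exp_pos _).le)) (fun _ => (Real.exp_pos _).le)
    (fun _ => mul_nonneg (Real.exp_pos _).le (Real.exp_pos _).le))
  have hinj : Function.Injective fun k : Fin 3 → ℤ => (k 0, k 1, k 2) := by
    intro k l h
    simp only [Prod.mk.injEq] at h
    funext i
    fin_cases i
    exacts [h.1, h.2.1, h.2.2]
  refine Summable.of_nonneg_of_le (fun _ => (Real.exp_pos _).le) (fun k => ?_)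
    (h2.comp_injective hinj)
  simp only [Function.comp_apply, ← Real.exp_add]
  rw [Real.exp_le_exp]
  nlinarith [abs_le_waveNorm k 0, abs_le_waveNorm k 1, abs_le_waveNorm k 2]

/-! ### The quadratic term -/

theorem norm_leray_le (k : Fin 3 → ℤ) (w : CSpace) : ‖leray k w‖ ≤ 2 * ‖w‖ := by
  set κ : CSpace := WithLp.toLp 2 fun i => (k i : ℂ) with hκ
  have hn : ‖κ‖ = waveNorm k := (waveNorm_eq_norm_complex k).symm
  set S : ℂ := ∑ j, (k j : ℂ) * w j with hS
  have hSi : S = inner ℂ κ w := by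
    simp only [hS, PiLp.inner_apply, RCLike.inner_apply, hκ, map_intCast]
    exact Finset.sum_congr rfl fun j _ => mul_comm _ _
  have hSn : ‖S‖ ≤ waveNorm k * ‖w‖ := by
    rw [hSi, ← hn]; exact norm_inner_le_norm _ _
  have e : leray k w = w - (S / (waveNorm k : ℂ) ^ 2) • κ := by
    ext i; simp [leray, hκ, hS]
  rw [e, two_mul]
  refine (norm_sub_le _ _).trans (add_le_add le_rfl ?_)
  rw [norm_smul, norm_div, norm_pow, Complex.norm_real, Real.norm_eq_abs,
    abs_of_nonneg (waveNorm_nonneg k), hn]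
  rcases (waveNorm_nonneg k).eq_or_lt with h | h
  · rw [← h]; simp
  · rw [div_mul_eq_mul_div, div_le_iff₀ (by positivity)]
    nlinarith

/-- `c` lies in the ball of radius `D` of the weighted space `ℓ²` with the weight `e^{γ|k|}`. -/
def GevreyBound (γ D : ℝ) (c : CoeffSeq) : Prop :=
  Summable (fun k => (Real.exp (γ * waveNorm k) * ‖c k‖) ^ 2) ∧
    ∑' k, (Real.exp (γ * waveNorm k) * ‖c k‖) ^ 2 ≤ D ^ 2

theorem GevreyBound.norm_le {γ D : ℝ} {c : CoeffSeq} (h : GevreyBound γ D c) (hD : 0 ≤ D)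
    (k : Fin 3 → ℤ) : ‖c k‖ ≤ D * Real.exp (-(γ * waveNorm k)) := by
  have h1 : (Real.exp (γ * waveNorm k) * ‖c k‖) ^ 2 ≤ D ^ 2 :=
    (h.1.le_tsum k fun _ _ => sq_nonneg _).trans h.2
  have h2 := (sq_le_sq₀ (by positivity) hD).mp h1
  rw [Real.exp_neg, ← div_eq_mul_inv, le_div_iff₀ (Real.exp_pos _), mul_comm]
  exact h2

theorem norm_component_le (v : CSpace) (i : Fin 3) : ‖v i‖ ≤ ‖v‖ := PiLp.norm_apply_le v i

theorem norm_le_sum_norm (v : CSpace) : ‖v‖ ≤ ∑ i, ‖v i‖ := by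
  rw [EuclideanSpace.norm_eq]
  refine Real.sqrt_le_iff.mpr ⟨Finset.sum_nonneg fun _ _ => norm_nonneg _, ?_⟩
  exact Finset.sum_sq_le_sq_sum_of_nonneg fun _ _ => norm_nonneg _

/-- By the triangle inequality the weight is submultiplicative, so `e^{-γ|k|}` factors out; `xy ≤
(x² + y²)/2` bounds what remains, both squares having the same sum over `l`. -/
theorem GevreyBound.convolution {γ D : ℝ} {c : CoeffSeq} (h : GevreyBound γ D c) (hγ : 0 ≤ γ)
    (k : Fin 3 → ℤ) : Summable (fun l => ‖c (k - l)‖ * ‖c l‖) ∧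
      ∑' l, ‖c (k - l)‖ * ‖c l‖ ≤ D ^ 2 * Real.exp (-(γ * waveNorm k)) := by
  set x : (Fin 3 → ℤ) → ℝ := fun k => Real.exp (γ * waveNorm k) * ‖c k‖ with hx
  have hs : Summable fun l => x (k - l) ^ 2 :=
    h.1.comp_injective (i := fun l => k - l) sub_right_injective
  have ht : ∑' l, x (k - l) ^ 2 = ∑' l, x l ^ 2 :=
    (Equiv.subLeft k).tsum_eq (fun l => x l ^ 2)
  have hle : ∀ l, ‖c (k - l)‖ * ‖c l‖ ≤
      Real.exp (-(γ * waveNorm k)) * ((x (k - l) ^ 2 + x l ^ 2) / 2) := by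
    intro l
    have h1 : x (k - l) * x l ≤ (x (k - l) ^ 2 + x l ^ 2) / 2 := by
      nlinarith [sq_nonneg (x (k - l) - x l)]
    have h2 : 1 ≤ Real.exp (-(γ * waveNorm k)) *
        (Real.exp (γ * waveNorm (k - l)) * Real.exp (γ * waveNorm l)) := by
      rw [← Real.exp_add, ← Real.exp_add]
      refine Real.one_le_exp ?_
      nlinarith [mul_le_mul_of_nonneg_left (waveNorm_le_add k l) hγ]
    calc ‖c (k - l)‖ * ‖c l‖ = 1 * (‖c (k - l)‖ * ‖c l‖) := (one_mul _).symm
      _ ≤ (Real.exp (-(γ * waveNorm k)) *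
        (Real.exp (γ * waveNorm (k - l)) * Real.exp (γ * waveNorm l))) *
          (‖c (k - l)‖ * ‖c l‖) := by gcongr
      _ = Real.exp (-(γ * waveNorm k)) * (x (k - l) * x l) := by simp only [hx]; ring
      _ ≤ _ := by gcongr
  have hsum : Summable fun l => Real.exp (-(γ * waveNorm k)) * ((x (k - l) ^ 2 + x l ^ 2) / 2) :=
    ((hs.add h.1).div_const 2).mul_left _
  have hS := Summable.of_nonneg_of_le (fun l => by positivity) hle hsum
  refine ⟨hS, (hS.tsum_le_tsum hle hsum).trans ?_⟩
  rw [tsum_mul_left, tsum_div_const, hs.tsum_add h.1, ht, mul_comm]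
  have := h.2
  gcongr
  linarith

/-- The constant is `18 = 2 · 3 · 3`: the crude bound for the projection, the three components, and
the sum over `j`. -/
theorem GevreyBound.norm_seqQuad_le {γ D : ℝ} {c : CoeffSeq} (h : GevreyBound γ D c) (hγ : 0 ≤ γ)
    (k : Fin 3 → ℤ) :
    ‖seqQuad c k‖ ≤ 18 * waveNorm k * D ^ 2 * Real.exp (-(γ * waveNorm k)) := by
  obtain ⟨hs, hle⟩ := h.convolution hγ k
  have hij : ∀ i j, ‖∑' l, c (k - l) j * c l i‖ ≤ D ^ 2 * Real.exp (-(γ * waveNorm k)) := by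
    intro i j
    have hb : ∀ l, ‖c (k - l) j * c l i‖ ≤ ‖c (k - l)‖ * ‖c l‖ := fun l => by
      rw [norm_mul]
      exact mul_le_mul (norm_component_le _ _) (norm_component_le _ _) (norm_nonneg _)
        (norm_nonneg _)
    exact (tsum_of_norm_bounded hs.hasSum hb).trans hle
  have hi : ∀ i, ‖seqConvection c k i‖ ≤
      3 * (waveNorm k * (D ^ 2 * Real.exp (-(γ * waveNorm k)))) := by
    intro i
    simp only [seqConvection, norm_mul, Complex.norm_I, one_mul]
    refine (norm_sum_le _ _).trans ?_
    refine (Finset.sum_le_card_nsmul _ _ (waveNorm k * (D ^ 2 * Real.exp (-(γ * waveNorm k))))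
      fun j _ => ?_).trans (by simp)
    rw [norm_mul, Complex.norm_intCast]
    exact mul_le_mul (abs_le_waveNorm k j) (hij i j) (norm_nonneg _) (waveNorm_nonneg k)
  have hc : ‖seqConvection c k‖ ≤
      3 * (3 * (waveNorm k * (D ^ 2 * Real.exp (-(γ * waveNorm k))))) := by
    refine (norm_le_sum_norm _).trans ?_
    refine (Finset.sum_le_card_nsmul _ _ _ fun i _ => hi i).trans (by simp)
  have := norm_leray_le k (seqConvection c k)
  rw [seqQuad]
  nlinarith

/-! ### Smoothing -/

/-- Duhamel's estimate for `y' = -λ y - q`. -/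
theorem norm_le_of_hasDerivAt_damped {E : Type*} [NormedAddCommGroup E] [NormedSpace ℝ E]
    {y q : ℝ → E} {r s L Y : ℝ} (hrs : r ≤ s) (hL : 0 < L)
    (hy : ∀ x ∈ Set.Icc r s, HasDerivAt y (-L • y x - q x) x)
    (hq : ∀ x ∈ Set.Icc r s, ‖q x‖ ≤ Y) :
    ‖y s‖ ≤ Real.exp (-(L * (s - r))) * ‖y r‖ + Y / L := by
  have hY : 0 ≤ Y := (norm_nonneg _).trans (hq r ⟨le_rfl, hrs⟩)
  have he : ∀ x, HasDerivAt (fun x => Real.exp (L * (x - r))) (Real.exp (L * (x - r)) * L) x :=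
    fun x => by
      have h1 : HasDerivAt (fun x => L * (x - r)) (L * 1) x :=
        ((hasDerivAt_id x).sub_const r).const_mul L
      simpa using h1.exp
  have hz : ∀ x ∈ Set.Icc r s, HasDerivAt (fun x => Real.exp (L * (x - r)) • y x)
      (-(Real.exp (L * (x - r)) • q x)) x := fun x hx => by
    have e : Real.exp (L * (x - r)) • (-L • y x - q x) + (Real.exp (L * (x - r)) * L) • y x =
        -(Real.exp (L * (x - r)) • q x) := by
      module
    exact ((he x).smul (hy x hx)).congr_deriv e
  have hB : ∀ x, HasDerivAt (fun x => ‖y r‖ + Y / L * (Real.exp (L * (x - r)) - 1))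
      (Y / L * (Real.exp (L * (x - r)) * L)) x := fun x =>
    (((he x).sub_const 1).const_mul (Y / L)).const_add _
  -- After multiplication by the integrating factor, growth is compared through derivatives rather
  -- than integrals, so `q` needs no measurability.
  have key := image_norm_le_of_norm_deriv_right_le_deriv_boundary' (a := r) (b := s)
    (fun x hx => (hz x hx).continuousAt.continuousWithinAt)
    (fun x hx => (hz x ⟨hx.1, hx.2.le⟩).hasDerivWithinAt)
    (B := fun x => ‖y r‖ + Y / L * (Real.exp (L * (x - r)) - 1))
    (by simp)
    (fun x _ => (hB x).continuousAt.continuousWithinAt)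
    (fun x _ => (hB x).hasDerivWithinAt)
    (fun x hx => by
      rw [norm_neg, norm_smul, Real.norm_eq_abs, abs_of_pos (Real.exp_pos _)]
      calc _ ≤ Real.exp (L * (x - r)) * Y :=
            mul_le_mul_of_nonneg_left (hq x ⟨hx.1, hx.2.le⟩) (Real.exp_pos _).le
        _ = _ := by field_simp) (Set.right_mem_Icc.mpr hrs)
  simp only [norm_smul, Real.norm_eq_abs, abs_of_pos (Real.exp_pos _)] at key
  have hE := Real.exp_pos (L * (s - r))
  rw [Real.exp_neg]
  have hYL : 0 ≤ Y / L := by positivity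
  calc ‖y s‖ = (Real.exp (L * (s - r)))⁻¹ * (Real.exp (L * (s - r)) * ‖y s‖) := by
        field_simp
    _ ≤ (Real.exp (L * (s - r)))⁻¹ * (‖y r‖ + Y / L * (Real.exp (L * (s - r)) - 1)) := by
        gcongr
    _ = (Real.exp (L * (s - r)))⁻¹ * ‖y r‖ + Y / L -
        (Real.exp (L * (s - r)))⁻¹ * (Y / L) := by field_simp; ring
    _ ≤ _ := by
        have : 0 ≤ (Real.exp (L * (s - r)))⁻¹ * (Y / L) := by positivity
        linarith

/-- The weight by which one smoothing step is controlled. -/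
def smoothingWeight (μ σ : ℝ) (k : Fin 3 → ℤ) : ℝ :=
  (1 + 18 * waveNorm k) * Real.exp (-(σ * waveNorm k)) / μ

theorem summable_smoothingWeight_sq {μ σ : ℝ} (hσ : 0 < σ) :
    Summable fun k => smoothingWeight μ σ k ^ 2 := by
  refine Summable.of_nonneg_of_le (fun _ => sq_nonneg _) (fun k => ?_)
    ((summable_exp_neg_waveNorm hσ).mul_left ((1 + 36 / σ) ^ 2 / μ ^ 2))
  have hx := waveNorm_nonneg k
  set x := waveNorm k
  -- Half of the exponential absorbs the linear factor: `(36/σ)(σx/2) = 18x`.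
  have h1 : 1 + 18 * x ≤ (1 + 36 / σ) * Real.exp (σ * x / 2) := by
    have ha : σ * x / 2 + 1 ≤ Real.exp (σ * x / 2) := Real.add_one_le_exp _
    have hb : 1 + 18 * x ≤ (1 + 36 / σ) * (σ * x / 2 + 1) := by
      have : (1 + 36 / σ) * (σ * x / 2 + 1) = 1 + 18 * x + σ * x / 2 + 36 / σ := by
        field_simp; ring
      rw [this]
      have : 0 ≤ σ * x / 2 := by positivity
      have : 0 ≤ 36 / σ := by positivity
      linarith
    exact hb.trans (by gcongr)
  have h2 : Real.exp (σ * x / 2) ^ 2 * Real.exp (-(σ * x)) ^ 2 = Real.exp (-(σ * x)) := by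
    rw [← Real.exp_nat_mul, ← Real.exp_nat_mul, ← Real.exp_add]
    congr 1; push_cast; ring
  calc smoothingWeight μ σ k ^ 2
      = (1 + 18 * x) ^ 2 * (Real.exp (-(σ * x)) ^ 2 / μ ^ 2) := by
        rw [smoothingWeight, div_pow, mul_pow, mul_div_assoc]
    _ ≤ ((1 + 36 / σ) * Real.exp (σ * x / 2)) ^ 2 * (Real.exp (-(σ * x)) ^ 2 / μ ^ 2) := by
        gcongr
    _ = (1 + 36 / σ) ^ 2 / μ ^ 2 * (Real.exp (σ * x / 2) ^ 2 * Real.exp (-(σ * x)) ^ 2) := by ring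
    _ = _ := by rw [h2]

/-- The constant of the smoothing step. -/
def smoothingConst (μ σ : ℝ) : ℝ := 1 + √(∑' k, smoothingWeight μ σ k ^ 2)

theorem one_le_smoothingConst (μ σ : ℝ) : 1 ≤ smoothingConst μ σ := by
  have := Real.sqrt_nonneg (∑' k, smoothingWeight μ σ k ^ 2)
  rw [smoothingConst]; linarith

theorem tsum_smoothingWeight_sq_le (μ σ : ℝ) :
    ∑' k, smoothingWeight μ σ k ^ 2 ≤ smoothingConst μ σ ^ 2 := by
  have h0 : 0 ≤ ∑' k, smoothingWeight μ σ k ^ 2 := tsum_nonneg fun _ => sq_nonneg _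
  rw [← Real.sqrt_le_left (by linarith [one_le_smoothingConst μ σ]), smoothingConst]
  linarith

theorem IsCoeffSolution.smoothing_step {μ σ M : ℝ} {a : ℝ → CoeffSeq} (hμ : 0 < μ) (hσ : 0 < σ)
    (h : IsCoeffSolution μ σ M a) {γ D r T τ : ℝ} (hγ : 0 ≤ γ) (hD : 0 ≤ D) (hr : 0 ≤ r)
    (hτ : 0 < τ) (hb : ∀ s, r < s → s < T → GevreyBound γ D (a s)) :
    ∀ s, r + τ < s → s < T →
      GevreyBound (γ + σ) (smoothingConst μ σ * (D / τ + D ^ 2)) (a s) := by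
  intro s hrs hsT
  have hpt : ∀ k, Real.exp ((γ + σ) * waveNorm k) * ‖a s k‖ ≤
      smoothingWeight μ σ k * (D / τ + D ^ 2) := by
    intro k
    have hx := waveNorm_nonneg k
    rcases eq_or_ne k 0 with rfl | hk
    · rw [h.zero s (by linarith), norm_zero, mul_zero, smoothingWeight]
      positivity
    set x := waveNorm k with hxdef
    set L : ℝ := μ * Real.exp (2 * σ * x) with hL
    have hLpos : 0 < L := by positivity
    have h1 := norm_le_of_hasDerivAt_damped (y := fun s => a s k) (q := fun s => seqQuad (a s) k)
      (r := s - τ) (s := s) (L := L) (Y := 18 * x * D ^ 2 * Real.exp (-(γ * x))) (by linarith) hLpos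
      (fun t ht => h.equation k hk t (by linarith [ht.1]))
      (fun t ht => (hb t (by linarith [ht.1]) (by linarith [ht.2])).norm_seqQuad_le hγ k)
    have h2 := (hb (s - τ) (by linarith) (by linarith)).norm_le hD k
    rw [sub_sub_cancel, ← hxdef] at *
    -- Only one power of `1/L` is taken from the initial term, to match the gain on the forcing
    -- term.
    have h3 : Real.exp (-(L * τ)) ≤ 1 / (L * τ) := by
      rw [Real.exp_neg, ← one_div]
      exact one_div_le_one_div_of_le (by positivity) (by linarith [Real.add_one_le_exp (L * τ)])
    have h4 : ‖a s k‖ ≤ Real.exp (-(γ * x)) / L * (D / τ + 18 * x * D ^ 2) := by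
      refine h1.trans ?_
      calc _ ≤ 1 / (L * τ) * (D * Real.exp (-(γ * x))) +
            18 * x * D ^ 2 * Real.exp (-(γ * x)) / L := by gcongr
        _ = _ := by field_simp
    have h5 : D / τ + 18 * x * D ^ 2 ≤ (1 + 18 * x) * (D / τ + D ^ 2) := by
      have e1 : 0 ≤ D / τ := by positivity
      have e2 : 0 ≤ D ^ 2 := by positivity
      nlinarith [mul_nonneg hx e1]
    have h6 : Real.exp ((γ + σ) * x) * (Real.exp (-(γ * x)) / L) = Real.exp (-(σ * x)) / μ := by
      rw [hL, mul_div_assoc', ← Real.exp_add, div_eq_div_iff (by positivity) hμ.ne',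
        mul_left_comm, ← Real.exp_add, mul_comm]
      congr 2; ring
    calc Real.exp ((γ + σ) * x) * ‖a s k‖
        ≤ Real.exp ((γ + σ) * x) *
          (Real.exp (-(γ * x)) / L * ((1 + 18 * x) * (D / τ + D ^ 2))) := by
          gcongr
          exact h4.trans (by gcongr)
      _ = Real.exp ((γ + σ) * x) * (Real.exp (-(γ * x)) / L) *
          ((1 + 18 * x) * (D / τ + D ^ 2)) := by ring
      _ = _ := by rw [h6, smoothingWeight]; ring
  have hsq : ∀ k, (Real.exp ((γ + σ) * waveNorm k) * ‖a s k‖) ^ 2 ≤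
      smoothingWeight μ σ k ^ 2 * (D / τ + D ^ 2) ^ 2 := fun k => by
    rw [← mul_pow]
    exact pow_le_pow_left₀ (by positivity) (hpt k) 2
  have hsum := (summable_smoothingWeight_sq (μ := μ) hσ).mul_right ((D / τ + D ^ 2) ^ 2)
  have hS := Summable.of_nonneg_of_le (fun k => sq_nonneg _) hsq hsum
  refine ⟨hS, (hS.tsum_le_tsum hsq hsum).trans ?_⟩
  rw [tsum_mul_right, mul_pow]
  gcongr
  exact tsum_smoothingWeight_sq_le μ σ

/-- The radii obtained by iterating the smoothing step on shrinking time intervals. -/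
def smoothingRadius (K M t : ℝ) : ℕ → ℝ
  | 0 => M
  | n + 1 => K * (smoothingRadius K M t n / (t / 2 ^ (n + 1)) + smoothingRadius K M t n ^ 2)

theorem smoothingRadius_nonneg {K M t : ℝ} (hK : 0 ≤ K) (hM : 0 ≤ M) (ht : 0 ≤ t) (n : ℕ) :
    0 ≤ smoothingRadius K M t n := by
  induction n with
  | zero => exact hM
  | succ n ih => rw [smoothingRadius]; positivity

/-- The constant governing the growth of the radii. -/
def growthConst (K M : ℝ) : ℝ := 8 * K + 2 * K ^ 2 * (2 * M + M ^ 2)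

theorem smoothingRadius_succ_le {K M t : ℝ} (hK : 1 ≤ K) (hM : 0 ≤ M) (ht : 0 < t) (ht1 : t ≤ 1)
    (n : ℕ) : smoothingRadius K M t (n + 1) ≤ (growthConst K M / t) ^ 2 ^ n / (2 * K) := by
  have hK0 : 0 < K := by linarith
  have hQ8 : 8 * K ≤ growthConst K M := by
    rw [growthConst]
    have : 0 ≤ 2 * K ^ 2 * (2 * M + M ^ 2) := by positivity
    linarith
  induction n with
  -- The summand `2K²(2M + M²)` of `growthConst` is exactly what this first radius needs.
  | zero =>
    simp only [smoothingRadius, pow_zero, pow_one, zero_add]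
    rw [div_div, le_div_iff₀ (by positivity), growthConst]
    have e : K * (M / (t / 2) + M ^ 2) * (t * (2 * K)) = 2 * K ^ 2 * (2 * M + M ^ 2 * t) := by
      field_simp
    rw [e]
    have : M ^ 2 * t ≤ M ^ 2 := mul_le_of_le_one_right (sq_nonneg _) ht1
    nlinarith [mul_le_mul_of_nonneg_left this (show 0 ≤ 2 * K ^ 2 by positivity)]
  | succ n ih =>
    set Q := growthConst K M with hQ
    have hQ0 : 0 < Q := by linarith
    set P := (Q / t) ^ 2 ^ n with hP
    have hP0 : 0 < P := by positivity
    have hR0 := smoothingRadius_nonneg hK0.le hM ht.le (n + 1)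
    set R := smoothingRadius K M t (n + 1)
    -- The summand `8K` of `growthConst` makes the linear term of the recursion no larger than the
    -- quadratic one; with the normalization `1/(2K)` each contributes at most `P²/(4K)`.
    have hlow : 2 ^ (n + 3) * K / t ≤ P := by
      have h1 : (8 * K / t) ^ 2 ^ n ≤ P := by rw [hP]; gcongr
      refine le_trans ?_ h1
      have h2 : (1 : ℝ) ≤ K / t := (one_le_div ht).mpr (ht1.trans hK)
      have h3 : K / t ≤ (K / t) ^ 2 ^ n := le_self_pow₀ h2 (by positivity)
      have h4 : (2 : ℝ) ^ (n + 3) ≤ 8 ^ 2 ^ n := by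
        have : n + 3 ≤ 3 * 2 ^ n := by
          have := Nat.lt_two_pow_self (n := n)
          omega
        calc (2 : ℝ) ^ (n + 3) ≤ 2 ^ (3 * 2 ^ n) := pow_le_pow_right₀ one_le_two this
          _ = 8 ^ 2 ^ n := by rw [pow_mul]; norm_num
      calc 2 ^ (n + 3) * K / t = 2 ^ (n + 3) * (K / t) := by ring
        _ ≤ 8 ^ 2 ^ n * (K / t) ^ 2 ^ n := by gcongr
        _ = _ := by rw [← mul_pow]; congr 1; ring
    rw [smoothingRadius]
    calc K * (R / (t / 2 ^ (n + 1 + 1)) + R ^ 2)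
        ≤ K * (P / (2 * K) / (t / 2 ^ (n + 1 + 1)) + (P / (2 * K)) ^ 2) := by gcongr
      _ = (2 ^ (n + 3) * K / t) * P / (4 * K) + P ^ 2 / (4 * K) := by
          field_simp
          ring
      _ ≤ P * P / (4 * K) + P ^ 2 / (4 * K) := by gcongr
      _ = P ^ 2 / (2 * K) := by field_simp; ring
      _ = _ := by rw [hP, ← pow_mul, ← pow_succ]

/-- The first `n` steps use up the time `t/2 + ⋯ + t/2^n = t(1 - 1/2^n)`, so any number of steps
fits into a span `t`. -/
theorem IsCoeffSolution.gevreyBound {μ σ M : ℝ} {a : ℝ → CoeffSeq} (hμ : 0 < μ) (hσ : 0 < σ)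
    (h : IsCoeffSolution μ σ M a) {D r T t : ℝ} (hD : 0 ≤ D) (hr : 0 ≤ r) (ht : 0 < t)
    (hb : ∀ s, r < s → s < T → GevreyBound 0 D (a s)) (n : ℕ) :
    ∀ s, r + t * (1 - 1 / 2 ^ n) < s → s < T →
      GevreyBound (n * σ) (smoothingRadius (smoothingConst μ σ) D t n) (a s) := by
  have hK := one_le_smoothingConst μ σ
  induction n with
  | zero => simpa [smoothingRadius] using hb
  | succ n ih =>
    intro s hs hsT
    have hle : (1 : ℝ) / 2 ^ n ≤ 1 := by
      rw [div_le_one (by positivity)]; exact one_le_pow₀ one_le_two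
    have := h.smoothing_step hμ hσ (γ := n * σ) (r := r + t * (1 - 1 / 2 ^ n))
      (τ := t / 2 ^ (n + 1)) (by positivity)
      (smoothingRadius_nonneg (by linarith) hD ht.le n)
      (by nlinarith) (by positivity) ih s (by
        convert hs using 1; rw [pow_succ]; field_simp; ring) hsT
    rw [smoothingRadius]
    convert this using 1
    push_cast; ring

theorem IsCoeffSolution.norm_le_of_bound {μ σ M : ℝ} {a : ℝ → CoeffSeq} (hμ : 0 < μ) (hσ : 0 < σ)
    (h : IsCoeffSolution μ σ M a) {D r T t : ℝ} (hD : 0 ≤ D) (hr : 0 ≤ r) (ht : 0 < t)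
    (ht1 : t ≤ 1) (hb : ∀ s, r < s → s < T → GevreyBound 0 D (a s)) (n : ℕ) {s : ℝ}
    (hs : r + t ≤ s) (hsT : s < T) (k : Fin 3 → ℤ) :
    ‖a s k‖ ≤ (growthConst (smoothingConst μ σ) D / t) ^ 2 ^ n *
      Real.exp (-((n + 1) * σ * waveNorm k)) := by
  have hK := one_le_smoothingConst μ σ
  have hK0 : 0 < smoothingConst μ σ := by linarith
  have hR := smoothingRadius_nonneg hK0.le hD ht.le (n + 1)
  have hpos : 0 < t * (1 / 2 ^ (n + 1)) := by positivity
  have h1 := (h.gevreyBound hμ hσ hD hr ht hb (n + 1) s (by nlinarith) hsT).norm_le hR k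
  push_cast at h1
  refine h1.trans ?_
  gcongr
  refine (smoothingRadius_succ_le hK hD ht ht1 n).trans (div_le_self ?_ (by linarith))
  have : 0 ≤ growthConst (smoothingConst μ σ) D := by rw [growthConst]; positivity
  positivity

/-! ### Cancellation of the quadratic term in the energy balance -/

/-- The summand of `⟨c, B(c, c)⟩` at the wave vectors `p.1` and `p.2`. -/
def energyTransfer (c : CoeffSeq) (p : (Fin 3 → ℤ) × (Fin 3 → ℤ)) : ℂ :=
  Complex.I * ((∑ j, (p.1 j : ℂ) * c (p.1 - p.2) j) * ∑ i, c p.2 i * c (-p.1) i)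

theorem norm_sum_mul_le (k : Fin 3 → ℤ) (v : CSpace) :
    ‖∑ j, (k j : ℂ) * v j‖ ≤ 3 * (waveNorm k * ‖v‖) := by
  refine (norm_sum_le _ _).trans ?_
  refine (Finset.sum_le_card_nsmul _ _ (waveNorm k * ‖v‖) fun j _ => ?_).trans (by simp)
  rw [norm_mul, Complex.norm_intCast]
  exact mul_le_mul (abs_le_waveNorm k j) (norm_component_le v j) (norm_nonneg _)
    (waveNorm_nonneg k)

theorem norm_sum_mul_le' (v w : CSpace) : ‖∑ i, v i * w i‖ ≤ 3 * (‖v‖ * ‖w‖) := by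
  refine (norm_sum_le _ _).trans ?_
  refine (Finset.sum_le_card_nsmul _ _ (‖v‖ * ‖w‖) fun j _ => ?_).trans (by simp)
  rw [norm_mul]
  exact mul_le_mul (norm_component_le v j) (norm_component_le w j) (norm_nonneg _)
    (norm_nonneg _)

theorem norm_neg_coeff {c : CoeffSeq} (hneg : ∀ k i, c (-k) i = conj (c k i)) (k : Fin 3 → ℤ) :
    ‖c (-k)‖ = ‖c k‖ := by
  simp only [EuclideanSpace.norm_eq, hneg, RCLike.norm_conj]

theorem summable_energyTransfer {c : CoeffSeq} (hneg : ∀ k i, c (-k) i = conj (c k i))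
    (h1 : Summable fun k => ‖c k‖) (h2 : Summable fun k => waveNorm k * ‖c k‖) :
    Summable (energyTransfer c) := by
  refine Summable.of_norm_bounded (g := fun p => 9 * (∑' k, ‖c k‖) *
    ((waveNorm p.1 * ‖c p.1‖) * ‖c p.2‖)) ?_ fun p => ?_
  · exact (h2.mul_of_nonneg h1 (fun k => mul_nonneg (waveNorm_nonneg k) (norm_nonneg _))
      fun _ => norm_nonneg _).mul_left _
  · have e1 := norm_sum_mul_le p.1 (c (p.1 - p.2))
    have e2 := norm_sum_mul_le' (c p.2) (c (-p.1))
    rw [norm_neg_coeff hneg] at e2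
    have e3 : ‖c (p.1 - p.2)‖ ≤ ∑' k, ‖c k‖ := h1.le_tsum _ fun _ _ => norm_nonneg _
    have e4 := waveNorm_nonneg p.1
    rw [energyTransfer, norm_mul, Complex.norm_I, one_mul, norm_mul]
    calc _ ≤ 3 * (waveNorm p.1 * ∑' k, ‖c k‖) * (3 * (‖c p.2‖ * ‖c p.1‖)) := by
          gcongr
          exact e1.trans (by gcongr)
      _ = _ := by ring

/-- The two sums over `i` agree after the swap, and `k · c(k-l) = l · c(k-l)` because `c(k-l)` is
orthogonal to `k - l`; only the sign of the wave vector changes. -/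
theorem energyTransfer_swap {c : CoeffSeq} (hdiv : ∀ k, ∑ j, (k j : ℂ) * c k j = 0)
    (k l : Fin 3 → ℤ) : energyTransfer c (-l, -k) = -energyTransfer c (k, l) := by
  have h1 : ∑ j, (k j : ℂ) * c (k - l) j = ∑ j, (l j : ℂ) * c (k - l) j := by
    have := hdiv (k - l)
    simp only [Pi.sub_apply, Int.cast_sub, sub_mul, Finset.sum_sub_distrib] at this
    exact sub_eq_zero.mp this
  have h2 : -l - -k = k - l := by abel
  simp only [energyTransfer, h1, h2, neg_neg, Pi.neg_apply, Int.cast_neg, neg_mul,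
    Finset.sum_neg_distrib, mul_neg]
  simp only [mul_comm (c l _)]

theorem tsum_energyTransfer {c : CoeffSeq} (hdiv : ∀ k, ∑ j, (k j : ℂ) * c k j = 0) :
    ∑' p, energyTransfer c p = 0 := by
  let e : (Fin 3 → ℤ) × (Fin 3 → ℤ) ≃ (Fin 3 → ℤ) × (Fin 3 → ℤ) :=
    (Equiv.prodComm _ _).trans ((Equiv.neg _).prodCongr (Equiv.neg _))
  have h : ∑' p, energyTransfer c p = -∑' p, energyTransfer c p := by
    conv_lhs => rw [← e.tsum_eq]
    rw [← tsum_neg]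
    exact tsum_congr fun p => energyTransfer_swap hdiv p.1 p.2
  exact self_eq_neg.mp h

theorem inner_seqQuad {γ D : ℝ} {c : CoeffSeq} (hb : GevreyBound γ D c) (hγ : 0 ≤ γ)
    (hneg : ∀ k i, c (-k) i = conj (c k i)) (hdiv : ∀ k, ∑ j, (k j : ℂ) * c k j = 0)
    (k : Fin 3 → ℤ) :
    inner ℂ (c k) (seqQuad c k) = ∑' l, energyTransfer c (k, l) := by
  have hs : ∀ i j, Summable fun l => c (k - l) j * c l i := fun i j =>
    Summable.of_norm_bounded (hb.convolution hγ k).1 fun l => by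
      rw [norm_mul]
      exact mul_le_mul (norm_component_le _ _) (norm_component_le _ _) (norm_nonneg _)
        (norm_nonneg _)
  -- The correction made by the projection is parallel to `k`, hence invisible to the
  -- divergence-free coefficient `c k`.
  have hort : ∑ i, (k i : ℂ) * c (-k) i = 0 := by
    have := congrArg conj (hdiv k)
    simpa only [map_sum, map_mul, map_intCast, map_zero, ← hneg] using this
  have h1 : inner ℂ (c k) (seqQuad c k) = ∑ i, seqConvection c k i * c (-k) i := by
    simp only [PiLp.inner_apply, RCLike.inner_apply, ← hneg, seqQuad, leray, sub_mul,
      Finset.sum_sub_distrib, mul_assoc]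
    rw [← Finset.mul_sum, hort, mul_zero, sub_zero]
  rw [h1]
  have h2 : ∀ l, energyTransfer c (k, l) =
      ∑ i, ∑ j, Complex.I * ((k j : ℂ) * ((c (k - l) j * c l i) * c (-k) i)) := fun l => by
    rw [energyTransfer, Finset.sum_mul_sum, Finset.sum_comm]
    simp only [Finset.mul_sum]
    exact Finset.sum_congr rfl fun i _ => Finset.sum_congr rfl fun j _ => by ring
  simp only [h2]
  have hs' : ∀ i j, Summable fun l =>
      Complex.I * ((k j : ℂ) * ((c (k - l) j * c l i) * c (-k) i)) := fun i j =>
    (((hs i j).mul_right _).mul_left _).mul_left _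
  rw [Summable.tsum_finsetSum fun i _ => summable_sum fun j _ => hs' i j]
  refine Finset.sum_congr rfl fun i _ => ?_
  rw [Summable.tsum_finsetSum fun j _ => hs' i j]
  simp only [seqConvection, tsum_mul_left, tsum_mul_right, Finset.mul_sum, Finset.sum_mul]
  exact Finset.sum_congr rfl fun j _ => by ring

/-- Absolute summability over pairs of wave vectors is what allows the antisymmetric double sum to
be evaluated as an iterated one. -/
theorem hasSum_inner_seqQuad {γ D : ℝ} {c : CoeffSeq} (hb : GevreyBound γ D c) (hγ : 0 ≤ γ)
    (hneg : ∀ k i, c (-k) i = conj (c k i)) (hdiv : ∀ k, ∑ j, (k j : ℂ) * c k j = 0)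
    (h1 : Summable fun k => ‖c k‖) (h2 : Summable fun k => waveNorm k * ‖c k‖) :
    HasSum (fun k => inner ℝ (c k) (seqQuad c k)) 0 := by
  have hs := summable_energyTransfer hneg h1 h2
  have h := hs.hasSum.prod_fiberwise fun k => (hs.prod_factor k).hasSum
  rw [tsum_energyTransfer hdiv] at h
  have h' := Complex.hasSum_re h
  simp only [← inner_seqQuad hb hγ hneg hdiv, Complex.zero_re] at h'
  exact h'

/-! ### Decay of the energy -/

theorem mul_exp_neg_le {s : ℝ} (hs : 0 < s) (x : ℝ) : x * Real.exp (-(s * x)) ≤ 1 / s := by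
  rw [Real.exp_neg, ← div_eq_mul_inv, div_le_div_iff₀ (Real.exp_pos _) hs]
  linarith [Real.add_one_le_exp (s * x)]

theorem gevreyBound_zero_iff {D : ℝ} {c : CoeffSeq} :
    GevreyBound 0 D c ↔ Summable (fun k => ‖c k‖ ^ 2) ∧ ∑' k, ‖c k‖ ^ 2 ≤ D ^ 2 := by
  simp [GevreyBound]

theorem IsCoeffSolution.exists_gevreyBound {μ σ M : ℝ} {a : ℝ → CoeffSeq}
    (h : IsCoeffSolution μ σ M a) (T : ℝ) :
    ∃ B, 0 ≤ B ∧ ∀ s, 0 < s → s < T → GevreyBound 0 B (a s) := by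
  obtain ⟨B, hB⟩ := h.bounded T
  refine ⟨|B|, abs_nonneg B, fun s hs hsT => gevreyBound_zero_iff.mpr ⟨h.summable s hs.le, ?_⟩⟩
  rw [sq_abs]
  exact hB s hs.le hsT.le

theorem IsCoeffSolution.hasDerivAt_energy {μ σ M : ℝ} {a : ℝ → CoeffSeq} (hμ : 0 < μ)
    (hσ : 0 < σ) (h : IsCoeffSolution μ σ M a) {t : ℝ} (ht : 0 < t) :
    ∃ d, HasDerivAt (fun s => ∑' k, ‖a s k‖ ^ 2) d t ∧ d ≤ -(2 * μ) * ∑' k, ‖a t k‖ ^ 2 := by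
  obtain ⟨B, hB0, hB⟩ := h.exists_gevreyBound (t + 1)
  set r := min (t / 2) 1 with hr
  have hr0 : 0 < r := lt_min (by linarith) one_pos
  have hrt : r < t := (min_le_left _ _).trans_lt (by linarith)
  set A := (growthConst (smoothingConst μ σ) B / r) ^ 2 ^ 3 with hA
  have hK := one_le_smoothingConst μ σ
  have hA0 : 0 ≤ A := by
    have : 0 ≤ growthConst (smoothingConst μ σ) B := by rw [growthConst]; positivity
    positivity
  -- Four smoothing steps (`n = 3`) give the rate `4σ`, which absorbs the factor `e^{2σ|k|}` of the
  -- dissipation with room for summation.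
  have hdec : ∀ s ∈ Set.Ioo r (t + 1), ∀ k,
      ‖a s k‖ ≤ A * Real.exp (-(4 * σ * waveNorm k)) := fun s hs k => by
    have := h.norm_le_of_bound hμ hσ hB0 le_rfl hr0 (min_le_right _ _) hB 3
      (s := s) (by linarith [hs.1]) hs.2 k
    norm_num at this
    exact this
  set g' : (Fin 3 → ℤ) → ℝ → ℝ := fun k s => 2 * inner ℝ (a s k)
    (-(μ * Real.exp (2 * σ * waveNorm k)) • a s k - seqQuad (a s) k) with hg'
  have hderiv : ∀ k, ∀ s ∈ Set.Ioo r (t + 1), HasDerivAt (fun s => ‖a s k‖ ^ 2) (g' k s) s := by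
    intro k s hs
    have hs0 : 0 < s := hr0.trans hs.1
    -- The equation is not available for the zero mode, but that mode vanishes at all nonnegative
    -- times.
    rcases eq_or_ne k 0 with rfl | hk
    · have e1 : g' 0 s = 0 := by simp [hg', h.zero s hs0.le]
      rw [e1]
      refine (hasDerivAt_const s (0 : ℝ)).congr_of_eventuallyEq ?_
      filter_upwards [lt_mem_nhds hs0] with y hy
      simp [h.zero y hy.le]
    · exact (h.equation k hk s hs0).norm_sq
  set C := 2 * A ^ 2 * μ + 36 * A * B ^ 2 / σ with hC
  have hbound : ∀ k, ∀ s ∈ Set.Ioo r (t + 1),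
      ‖g' k s‖ ≤ C * Real.exp (-(σ * waveNorm k)) := by
    intro k s hs
    have hs0 : 0 < s := hr0.trans hs.1
    have hx := waveNorm_nonneg k
    set x := waveNorm k with hxd
    have hq := (hB s hs0 hs.2).norm_seqQuad_le le_rfl k
    rw [zero_mul, neg_zero, Real.exp_zero, mul_one, ← hxd] at hq
    have ha := hdec s hs k
    rw [← hxd] at ha
    set E := Real.exp (-(σ * x)) with hE
    have hE1 : E ≤ 1 := Real.exp_le_one_iff.mpr (by nlinarith)
    have hE0 : 0 < E := Real.exp_pos _
    have e4 : Real.exp (-(4 * σ * x)) = E ^ 4 := by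
      rw [hE, ← Real.exp_nat_mul]; congr 1; push_cast; ring
    have e2 : Real.exp (2 * σ * x) * E ^ 4 = E ^ 2 := by
      rw [hE, ← Real.exp_nat_mul, ← Real.exp_nat_mul, ← Real.exp_add]; congr 1; push_cast; ring
    have hxE : x * E ≤ 1 / σ := mul_exp_neg_le hσ x
    rw [e4] at ha
    have hn : ‖-(μ * Real.exp (2 * σ * x)) • a s k - seqQuad (a s) k‖ ≤
        μ * (A * E ^ 2) + 18 * x * B ^ 2 := by
      refine (norm_sub_le _ _).trans (add_le_add ?_ hq)
      rw [norm_smul, norm_neg, Real.norm_eq_abs, abs_of_pos (by positivity)]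
      calc _ ≤ μ * Real.exp (2 * σ * x) * (A * E ^ 4) := by gcongr
        _ = _ := by rw [← e2]; ring
    rw [hg', Real.norm_eq_abs, abs_mul, abs_two]
    calc _ ≤ 2 * (A * E ^ 4 * (μ * (A * E ^ 2) + 18 * x * B ^ 2)) := by
          gcongr
          exact (abs_real_inner_le_norm _ _).trans (by gcongr)
      _ = 2 * A ^ 2 * μ * (E ^ 5 * E) + 36 * A * B ^ 2 * (x * E) * (E ^ 2 * E) := by ring
      _ ≤ 2 * A ^ 2 * μ * (1 * E) + 36 * A * B ^ 2 * (1 / σ) * (1 * E) := by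
          gcongr
          · exact pow_le_one₀ hE0.le hE1
          · exact pow_le_one₀ hE0.le hE1
      _ = _ := by rw [hC]; ring
  have htI : t ∈ Set.Ioo r (t + 1) := ⟨hrt, by linarith⟩
  have hsumb := (summable_exp_neg_waveNorm hσ).mul_left C
  have hD := hasDerivAt_tsum_of_isPreconnected hsumb isOpen_Ioo isPreconnected_Ioo hderiv hbound
    htI (h.summable t ht.le) htI
  refine ⟨_, hD, ?_⟩
  have hexp := fun c : ℝ => fun hc : 0 < c => summable_exp_neg_waveNorm hc
  have hS1 : Summable fun k => ‖a t k‖ :=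
    Summable.of_nonneg_of_le (fun _ => norm_nonneg _) (hdec t htI)
      ((hexp (4 * σ) (by positivity)).mul_left A)
  have hS2 : Summable fun k => waveNorm k * ‖a t k‖ := by
    refine Summable.of_nonneg_of_le (fun k => mul_nonneg (waveNorm_nonneg k) (norm_nonneg _))
      (fun k => ?_) ((hexp (3 * σ) (by positivity)).mul_left (A * (1 / σ)))
    have e : Real.exp (-(4 * σ * waveNorm k)) =
        Real.exp (-(σ * waveNorm k)) * Real.exp (-(3 * σ * waveNorm k)) := by
      rw [← Real.exp_add]; congr 1; ring
    calc _ ≤ waveNorm k * (A * Real.exp (-(4 * σ * waveNorm k))) :=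
          mul_le_mul_of_nonneg_left (hdec t htI k) (waveNorm_nonneg k)
      _ = A * (waveNorm k * Real.exp (-(σ * waveNorm k))) * Real.exp (-(3 * σ * waveNorm k)) := by
          rw [e]; ring
      _ ≤ _ := by gcongr; exact mul_exp_neg_le hσ _
  have hcancel := hasSum_inner_seqQuad (hB t ht (by linarith)) le_rfl (h.neg t ht.le)
    (h.divFree t ht.le) hS1 hS2
  have hsg : Summable fun k => g' k t := Summable.of_norm_bounded hsumb fun k => hbound k t htI
  have hsum1 := hsg.hasSum.add (hcancel.mul_left 2)
  rw [mul_zero, add_zero] at hsum1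
  have hsum2 := (h.summable t ht.le).hasSum.mul_left (-(2 * μ))
  refine hasSum_le (fun k => ?_) hsum1 hsum2
  simp only [hg', inner_sub_right, inner_smul_right_eq_smul, smul_eq_mul,
    real_inner_self_eq_norm_sq]
  have h1 : 1 ≤ Real.exp (2 * σ * waveNorm k) :=
    Real.one_le_exp (by have := waveNorm_nonneg k; positivity)
  have h2 := mul_le_mul_of_nonneg_left h1 (mul_nonneg hμ.le (sq_nonneg ‖a t k‖))
  nlinarith

theorem IsCoeffSolution.energy_le {μ σ M : ℝ} {a : ℝ → CoeffSeq} (hμ : 0 < μ) (hσ : 0 < σ)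
    (h : IsCoeffSolution μ σ M a) {t : ℝ} (ht : 0 < t) :
    ∑' k, ‖a t k‖ ^ 2 ≤ M ^ 2 * Real.exp (-(2 * μ * t)) := by
  set f : ℝ → ℝ := fun s => ∑' k, ‖a s k‖ ^ 2 with hf
  choose! d hd hdle using fun t (ht : 0 < t) => h.hasDerivAt_energy hμ hσ ht
  have he : ∀ s, HasDerivAt (fun s => Real.exp (2 * μ * s)) (Real.exp (2 * μ * s) * (2 * μ)) s :=
    fun s => by simpa using ((hasDerivAt_id s).const_mul (2 * μ)).exp
  have hg : ∀ s, 0 < s → HasDerivAt (fun s => Real.exp (2 * μ * s) * f s)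
      (Real.exp (2 * μ * s) * (2 * μ) * f s + Real.exp (2 * μ * s) * d s) s :=
    fun s hs => (he s).mul (hd s hs)
  -- The energy is differentiable at positive times only; the value at zero enters by letting `s →
  -- 0` and then `η → 0`.
  have hanti : AntitoneOn (fun s => Real.exp (2 * μ * s) * f s) (Set.Ioi 0) := by
    refine antitoneOn_of_deriv_nonpos (convex_Ioi 0)
      (fun s hs => (hg s hs).continuousAt.continuousWithinAt)
      (fun s hs => ?_) (fun s hs => ?_)
    · rw [interior_Ioi] at hs
      exact (hg s hs).differentiableAt.differentiableWithinAt
    · rw [interior_Ioi] at hs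
      rw [(hg s hs).deriv]
      have := mul_le_mul_of_nonneg_left (hdle s hs) (Real.exp_pos (2 * μ * s)).le
      linarith
  have key : ∀ η, 0 < η → Real.exp (2 * μ * t) * f t ≤ (M + η) ^ 2 := by
    intro η hη
    have hlim : Tendsto (fun s : ℝ => Real.exp (2 * μ * s) * (M + η) ^ 2) (𝓝[>] 0)
        (𝓝 ((M + η) ^ 2)) := by
      have : Continuous fun s : ℝ => Real.exp (2 * μ * s) * (M + η) ^ 2 := by fun_prop
      simpa using (this.tendsto 0).mono_left nhdsWithin_le_nhds
    refine ge_of_tendsto hlim ?_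
    filter_upwards [h.initial η hη, Ioo_mem_nhdsGT ht] with s hs hs0
    exact (hanti hs0.1 ht hs0.2.le).trans (mul_le_mul_of_nonneg_left hs (Real.exp_pos _).le)
  have key2 : Real.exp (2 * μ * t) * f t ≤ M ^ 2 := by
    have hlim : Tendsto (fun η : ℝ => (M + η) ^ 2) (𝓝[>] 0) (𝓝 (M ^ 2)) := by
      have : Continuous fun η : ℝ => (M + η) ^ 2 := by fun_prop
      simpa using (this.tendsto 0).mono_left nhdsWithin_le_nhds
    refine ge_of_tendsto hlim ?_
    filter_upwards [self_mem_nhdsWithin] with η hη using key η hη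
  rw [Real.exp_neg, ← div_eq_mul_inv, le_div_iff₀ (Real.exp_pos _), mul_comm]
  exact key2

/-! ### Decay of the Fourier coefficients -/

theorem IsCoeffSolution.gevreyBound_zero {μ σ M : ℝ} {a : ℝ → CoeffSeq} (hμ : 0 < μ) (hσ : 0 < σ)
    (h : IsCoeffSolution μ σ M a) {t : ℝ} (ht : 0 < t) : GevreyBound 0 M (a t) := by
  refine gevreyBound_zero_iff.mpr ⟨h.summable t ht.le, (h.energy_le hμ hσ ht).trans ?_⟩
  exact mul_le_of_le_one_right (sq_nonneg M) (Real.exp_le_one_iff.mpr (by nlinarith))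

theorem sq_add_one_le_growthConst {K M : ℝ} (hK : 1 ≤ K) (hM : 0 ≤ M) :
    M ^ 2 + 1 ≤ growthConst K M := by
  rw [growthConst]
  have h1 : (1 : ℝ) ≤ K ^ 2 := one_le_pow₀ hK
  nlinarith [mul_le_mul_of_nonneg_right h1 (show 0 ≤ 2 * M + M ^ 2 by positivity)]

/-- The constant in the pointwise decay estimate. -/
def decayConst (μ σ M : ℝ) : ℝ := growthConst (smoothingConst μ σ) M * Real.exp (2 * σ)

theorem one_le_decayConst {μ σ M : ℝ} (hσ : 0 < σ) (hM : 0 ≤ M) : 1 ≤ decayConst μ σ M := by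
  have h1 := sq_add_one_le_growthConst (one_le_smoothingConst μ σ) hM
  have h2 : 1 ≤ Real.exp (2 * σ) := Real.one_le_exp (by positivity)
  exact one_le_mul_of_one_le_of_one_le (by nlinarith [sq_nonneg M]) h2

theorem IsCoeffSolution.norm_le {μ σ M : ℝ} {a : ℝ → CoeffSeq} (hμ : 0 < μ) (hσ : 0 < σ)
    (hM : 0 ≤ M) (h : IsCoeffSolution μ σ M a) {t τ : ℝ} (hτ : 0 < τ) (hτ1 : τ ≤ 1) (hτt : τ ≤ t)
    {k : Fin 3 → ℤ} (hk : k ≠ 0) :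
    ‖a t k‖ ≤ (decayConst μ σ M / τ) ^ (waveNorm k / 2) *
      Real.exp (-(σ / Real.log 2 * (waveNorm k * Real.log (waveNorm k)))) := by
  have hx1 := one_le_waveNorm hk
  set x := waveNorm k with hx
  have hx0 : 0 < x := by linarith
  set Q := growthConst (smoothingConst μ σ) M with hQ
  have hQM : M ^ 2 + 1 ≤ Q := sq_add_one_le_growthConst (one_le_smoothingConst μ σ) hM
  have hQ1 : 1 ≤ Q := by nlinarith [sq_nonneg M]
  have hQτ : 1 ≤ Q / τ := (one_le_div hτ).mpr (hτ1.trans hQ1)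
  have hb : ∀ s, t - τ < s → s < t + 1 → GevreyBound 0 M (a s) := fun s hs _ =>
    h.gevreyBound_zero hμ hσ (by linarith)
  -- With `2^m ≤ |k| < 2^(m+1)`, `m` smoothing steps raise `Q/τ` to the power `2^(m-1) ≤ |k|/2`
  -- only. For `m = 0` the energy bound suffices, as `M² ≤ Q`.
  obtain ⟨m, hm1, hm2⟩ := exists_nat_pow_near hx1 one_lt_two
  have hmain : ‖a t k‖ ≤ (Q / τ) ^ (x / 2) * Real.exp (-(m * σ * x)) := by
    cases m with
    | zero =>
      have h1 := (h.gevreyBound_zero hμ hσ (hτ.trans_le hτt)).norm_le hM k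
      simp only [zero_mul, neg_zero, Real.exp_zero, mul_one, CharP.cast_eq_zero] at h1 ⊢
      refine h1.trans ?_
      calc M ≤ √(Q / τ) := Real.le_sqrt_of_sq_le (by
            rw [le_div_iff₀ hτ]; nlinarith [sq_nonneg M])
        _ = (Q / τ) ^ (1 / 2 : ℝ) := Real.sqrt_eq_rpow _
        _ ≤ _ := Real.rpow_le_rpow_of_exponent_le hQτ (by linarith)
    | succ n =>
      have h1 := h.norm_le_of_bound hμ hσ hM (r := t - τ) (by linarith) hτ hτ1 hb n
        (s := t) (by linarith) (by linarith) k
      refine h1.trans ?_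
      push_cast
      gcongr
      rw [← Real.rpow_natCast]
      refine Real.rpow_le_rpow_of_exponent_le hQτ ?_
      push_cast
      rw [pow_succ] at hm1
      linarith
  have hl2 : 0 < Real.log 2 := Real.log_pos one_lt_two
  have hlog : Real.log x / Real.log 2 ≤ m + 1 := by
    rw [div_le_iff₀ hl2]
    have := Real.log_le_log hx0 hm2.le
    rw [Real.log_pow] at this
    exact_mod_cast this
  -- Replacing `m` by `log₂|k| - 1` costs `e^{σ|k|}`, which is the factor `e^{2σ}` in `decayConst`.
  have hexp : Real.exp (-(m * σ * x)) ≤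
      Real.exp (2 * σ) ^ (x / 2) * Real.exp (-(σ / Real.log 2 * (x * Real.log x))) := by
    rw [← Real.exp_mul, ← Real.exp_add, Real.exp_le_exp]
    have h1 := mul_le_mul_of_nonneg_left hlog (show 0 ≤ σ * x by positivity)
    have h2 : σ / Real.log 2 * (x * Real.log x) = σ * x * (Real.log x / Real.log 2) := by ring
    rw [h2]
    linarith
  calc ‖a t k‖ ≤ (Q / τ) ^ (x / 2) * (Real.exp (2 * σ) ^ (x / 2) *
        Real.exp (-(σ / Real.log 2 * (x * Real.log x)))) := by
        refine hmain.trans ?_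
        gcongr
    _ = _ := by
        rw [← mul_assoc, ← Real.mul_rpow (by positivity) (Real.exp_pos _).le, decayConst,
          div_mul_eq_mul_div]

theorem exists_norm_le_of_large_time {μ σ M β : ℝ} (hμ : 0 < μ) (hσ : 0 < σ) (hM : 0 ≤ M)
    (hβ : Real.log 2 < β) :
    ∃ T, 1 ≤ T ∧ ∀ a, IsCoeffSolution μ σ M a → ∀ t, T ≤ t → ∀ k : Fin 3 → ℤ, k ≠ 0 →
      ‖a t k‖ ≤ Real.exp (-(σ / β * (waveNorm k * Real.log (waveNorm k)))) := by
  have hl2 : 0 < Real.log 2 := Real.log_pos one_lt_two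
  have hβ0 : 0 < β := hl2.trans hβ
  set δ := σ / Real.log 2 - σ / β with hδ
  have hδ0 : 0 < δ := sub_pos.mpr (div_lt_div_of_pos_left hσ hl2 hβ)
  set Q := decayConst μ σ M with hQ
  have hQ1 : 1 ≤ Q := one_le_decayConst hσ hM
  -- Beyond `ln|k| = ρ` the gap `δ` between the two rates outweighs `Q^(|k|/2)`. The remaining modes
  -- have `|k| ≤ R`, and `T` is the time at which energy decay has made them small enough.
  set ρ := Real.log Q / (2 * δ) with hρ
  have hρ0 : 0 ≤ ρ := div_nonneg (Real.log_nonneg hQ1) (by positivity)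
  set R := Real.exp ρ with hR
  set T := max 1 (M * Real.exp (σ / β * (R * ρ)) / μ) with hT
  refine ⟨T, le_max_left _ _, fun a h t ht k hk => ?_⟩
  have ht1 : 1 ≤ t := (le_max_left _ _).trans ht
  have ht0 : 0 < t := by linarith
  have hx1 := one_le_waveNorm hk
  set x := waveNorm k with hx
  have hx0 : 0 < x := by linarith
  have hlx : 0 ≤ Real.log x := Real.log_nonneg hx1
  rcases le_total ρ (Real.log x) with hc | hc
  · have h1 := h.norm_le hμ hσ hM one_pos le_rfl ht1 hk
    rw [← hQ, div_one, ← hx] at h1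
    refine h1.trans ?_
    rw [Real.rpow_def_of_pos (by linarith), ← Real.exp_add, Real.exp_le_exp]
    rw [hρ, div_le_iff₀ (by positivity)] at hc
    have h2 := mul_le_mul_of_nonneg_left hc hx0.le
    have h3 : σ / Real.log 2 = δ + σ / β := by rw [hδ]; ring
    rw [h3]
    linarith
  · have hxR : x ≤ R := by rw [hR, ← Real.exp_log hx0]; exact Real.exp_le_exp.mpr hc
    have h1 : ‖a t k‖ ^ 2 ≤ (M * Real.exp (-(μ * t))) ^ 2 := by
      refine ((h.summable t ht0.le).le_tsum k fun _ _ => sq_nonneg _).trans ?_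
      refine (h.energy_le hμ hσ ht0).trans_eq ?_
      rw [mul_pow, ← Real.exp_nat_mul]
      congr 2; push_cast; ring
    have h2 := (sq_le_sq₀ (norm_nonneg _) (by positivity)).mp h1
    have h3 : M * Real.exp (-(μ * t)) ≤ Real.exp (-(σ / β * (R * ρ))) := by
      rw [Real.exp_neg, Real.exp_neg, ← div_eq_mul_inv, ← one_div, div_le_div_iff₀ (Real.exp_pos _)
        (Real.exp_pos _), one_mul]
      have h4 := (le_max_right 1 _).trans ht
      rw [div_le_iff₀ hμ] at h4
      linarith [Real.add_one_le_exp (μ * t)]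
    refine h2.trans (h3.trans (Real.exp_le_exp.mpr (neg_le_neg ?_)))
    gcongr

theorem log_two_lt_beta {κ δ : ℝ} (hκ : 3 < κ) (hδ : 0 < δ) : Real.log 2 < beta κ δ := by
  have h : 2 < (4 * κ - 5) / (2 * κ - 5) := by
    rw [lt_div_iff₀ (by linarith)]; linarith
  refine Real.log_lt_log two_pos ?_
  nlinarith

theorem exists_norm_le_of_threshold {μ σ M β : ℝ} (hμ : 0 < μ) (hσ : 0 < σ) (hM : 0 ≤ M)
    (hβ : Real.log 2 < β) :
    ∃ N, 0 < N ∧ ∀ a, IsCoeffSolution μ σ M a → ∀ t, 0 < t → ∀ ε, 0 < ε → ε < 1 →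
      ∀ k : Fin 3 → ℤ, √(N / t) ^ (β / (ε * σ)) ≤ waveNorm k →
        ‖a t k‖ ≤ Real.exp (-(σ * (1 - ε) / β) * (waveNorm k * Real.log (waveNorm k))) := by
  obtain ⟨T, hT1, hT⟩ := exists_norm_le_of_large_time hμ hσ hM hβ
  have hl2 : 0 < Real.log 2 := Real.log_pos one_lt_two
  have hβ0 : 0 < β := hl2.trans hβ
  have hQ1 : 1 ≤ decayConst μ σ M := one_le_decayConst hσ hM
  set Q := decayConst μ σ M with hQ
  -- The factor `T` gives `Q / min t 1 ≤ QT/t` for all `t ≤ T`; later times need no threshold beyond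
  -- `k ≠ 0`.
  refine ⟨Q * T, by positivity, fun a h t ht ε hε hε1 k hthr => ?_⟩
  have hk : k ≠ 0 := by
    rintro rfl
    rw [waveNorm_zero] at hthr
    have : 0 < √(Q * T / t) ^ (β / (ε * σ)) := by positivity
    linarith
  have hx1 := one_le_waveNorm hk
  set x := waveNorm k with hx
  have hx0 : 0 < x := by linarith
  have hlx : 0 ≤ Real.log x := Real.log_nonneg hx1
  have hsplit : -(σ * (1 - ε) / β) * (x * Real.log x) =
      -(σ / β * (x * Real.log x)) + x * (σ * ε / β * Real.log x) := by ring
  rw [hsplit]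
  rcases le_total T t with hc | hc
  · refine (hT a h t hc k hk).trans (Real.exp_le_exp.mpr ?_)
    have : 0 ≤ x * (σ * ε / β * Real.log x) := by positivity
    linarith
  · set N := Q * T / t with hN
    have hN0 : 0 < N := by positivity
    have hτ : 0 < min t 1 := lt_min ht one_pos
    have h1 := h.norm_le hμ hσ hM hτ (min_le_right _ _) (min_le_left _ _) hk
    have h2 : Q / min t 1 ≤ N := by
      rw [hN, div_le_div_iff₀ hτ ht, mul_assoc]
      refine mul_le_mul_of_nonneg_left ?_ (by linarith)
      rcases le_total t 1 with h3 | h3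
      · rw [min_eq_left h3]; nlinarith
      · rw [min_eq_right h3]; linarith
    -- This is the logarithm of the threshold: the share `ε` of the decay rate pays for `N^(|k|/2)`.
    have h4 : Real.log N / 2 ≤ σ * ε / β * Real.log x := by
      have h5 := Real.log_le_log (by positivity) hthr
      rw [Real.log_rpow (by positivity), Real.log_sqrt hN0.le, div_mul_eq_mul_div,
        div_le_iff₀ (by positivity)] at h5
      rw [div_mul_eq_mul_div, le_div_iff₀ hβ0]
      linarith
    have h6 : Real.exp (-(σ / Real.log 2 * (x * Real.log x))) ≤
        Real.exp (-(σ / β * (x * Real.log x))) := by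
      gcongr
    calc ‖a t k‖ ≤ N ^ (x / 2) * Real.exp (-(σ / β * (x * Real.log x))) := by
          refine h1.trans ?_
          rw [← hx]
          gcongr
      _ ≤ _ := by
          rw [Real.rpow_def_of_pos hN0, ← Real.exp_add, Real.exp_le_exp]
          have := mul_le_mul_of_nonneg_left h4 hx0.le
          linarith

theorem tendsto_waveNorm_cofinite : Tendsto waveNorm cofinite atTop := by
  have h := (summable_exp_neg_waveNorm one_pos).tendsto_cofinite_zero
  rw [Real.tendsto_exp_comp_nhds_zero] at h
  exact (tendsto_neg_atBot_atTop.comp h).congr fun k => by simp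

theorem IsCoeffSolution.isLittleO {μ σ M : ℝ} {a : ℝ → CoeffSeq} (hμ : 0 < μ) (hσ : 0 < σ)
    (hM : 0 ≤ M) (h : IsCoeffSolution μ σ M a) {t C : ℝ} (ht : 0 < t)
    (hC : C < 1 / (2 * Real.log 2)) :
    (fun k => a t k) =o[cofinite] fun k : Fin 3 → ℤ =>
      Real.exp (-C * ((2 * σ * waveNorm k) * Real.log (2 * σ * waveNorm k))) := by
  have hl2 : 0 < Real.log 2 := Real.log_pos one_lt_two
  have hτ : 0 < min t 1 := lt_min ht one_pos
  have hQ1 : 1 ≤ decayConst μ σ M := one_le_decayConst hσ hM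
  set N := decayConst μ σ M / min t 1 with hN
  have hN0 : 0 < N := by positivity
  set δ := σ / Real.log 2 - 2 * σ * C with hδ
  have hδ0 : 0 < δ := by
    rw [hδ, sub_pos, lt_div_iff₀ hl2]
    rw [lt_div_iff₀ (by positivity)] at hC
    nlinarith
  set b := Real.log N / 2 + 2 * σ * C * Real.log (2 * σ) with hb
  have hne : ∀ᶠ k : Fin 3 → ℤ in cofinite, k ≠ 0 := (Set.finite_singleton 0).compl_mem_cofinite
  have hbig : (fun k => a t k) =O[cofinite] fun k : Fin 3 → ℤ =>
      Real.exp (Real.log N * (waveNorm k / 2) -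
        σ / Real.log 2 * (waveNorm k * Real.log (waveNorm k))) := by
    refine Asymptotics.IsBigO.of_bound 1 ?_
    filter_upwards [hne] with k hk
    have h1 := h.norm_le hμ hσ hM hτ (min_le_right _ _) (min_le_left _ _) hk
    rw [← hN, Real.rpow_def_of_pos hN0, ← Real.exp_add, ← sub_eq_add_neg] at h1
    rwa [one_mul, Real.norm_eq_abs, abs_of_pos (Real.exp_pos _)]
  refine hbig.trans_isLittleO (Real.isLittleO_exp_comp_exp_comp.mpr ?_)
  -- This is the difference of the two exponents; the shift `ln (2σ)` and the factor `N^(|k|/2)`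
  -- only affect the linear term `b x`.
  have hlim : Tendsto (fun x : ℝ => x * (δ * Real.log x - b)) atTop atTop :=
    tendsto_id.atTop_mul_atTop₀
      (tendsto_atTop_add_const_right _ _ (Real.tendsto_log_atTop.const_mul_atTop hδ0))
  refine (hlim.comp tendsto_waveNorm_cofinite).congr' ?_
  filter_upwards [hne] with k hk
  have hx0 : 0 < waveNorm k := by linarith [one_le_waveNorm hk]
  simp only [Function.comp_apply]
  rw [Real.log_mul (by positivity) hx0.ne', hδ, hb]
  ring

theorem IsCoeffSolution.exists_norm_le_exp {μ σ M : ℝ} {a : ℝ → CoeffSeq} (hμ : 0 < μ)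
    (hσ : 0 < σ) (h : IsCoeffSolution μ σ M a) {t : ℝ} (ht : 0 < t) (γ : ℝ) :
    ∃ A, ∀ k, ‖a t k‖ ≤ A * Real.exp (-(γ * waveNorm k)) := by
  obtain ⟨B, hB0, hB⟩ := h.exists_gevreyBound (t + 1)
  obtain ⟨n, hn⟩ := exists_nat_ge (γ / σ)
  rw [div_le_iff₀ hσ] at hn
  have hτ : 0 < min t 1 := lt_min ht one_pos
  refine ⟨(growthConst (smoothingConst μ σ) B / min t 1) ^ 2 ^ n, fun k => ?_⟩
  refine (h.norm_le_of_bound hμ hσ hB0 le_rfl hτ (min_le_right _ _) hB n (s := t)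
    (by rw [zero_add]; exact min_le_left _ _) (by linarith) k).trans ?_
  have hK := one_le_smoothingConst μ σ
  have h0 : 0 ≤ growthConst (smoothingConst μ σ) B := by rw [growthConst]; positivity
  have := waveNorm_nonneg k
  gcongr
  linarith

/-! ### Entire extension -/

/-- The linear form `z ↦ i k·z` on `ℂ³`. -/
def phase (k : Fin 3 → ℤ) : CSpace →L[ℂ] ℂ :=
  Complex.I • ∑ j, (k j : ℂ) • EuclideanSpace.proj j

theorem phase_apply (k : Fin 3 → ℤ) (z : CSpace) :
    phase k z = Complex.I * ∑ j, (k j : ℂ) * z j := by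
  simp [phase]

theorem norm_phase_apply_le (k : Fin 3 → ℤ) (z : CSpace) :
    ‖phase k z‖ ≤ 3 * waveNorm k * ‖z‖ := by
  rw [phase_apply, norm_mul, Complex.norm_I, one_mul, mul_assoc]
  exact norm_sum_mul_le k z

/-- The Fourier series with coefficients `c` at complex arguments. -/
def complexSeries (c : CoeffSeq) (z : CSpace) : CSpace := ∑' k, Complex.exp (phase k z) • c k

theorem differentiable_complexSeries {c : CoeffSeq}
    (hc : ∀ γ, ∃ A, ∀ k, ‖c k‖ ≤ A * Real.exp (-(γ * waveNorm k))) :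
    Differentiable ℂ (complexSeries c) := by
  intro z
  set R := ‖z‖ + 1 with hR
  have hR0 : 0 < R := by positivity
  -- The rate `3R` offsets the growth of `e^{ik·z}` on the ball of radius `R`; one further unit
  -- absorbs the factor `|k|` from differentiation, the other ensures summability.
  obtain ⟨A, hA⟩ := hc (3 * R + 2)
  have hA0 : 0 ≤ A := by
    have := (norm_nonneg _).trans (hA 0)
    rwa [waveNorm_zero, mul_zero, neg_zero, Real.exp_zero, mul_one] at this
  have hderiv : ∀ k, ∀ y ∈ Metric.ball (0 : CSpace) R,
      HasFDerivAt (fun y => Complex.exp (phase k y) • c k)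
        ((Complex.exp (phase k y) • phase k).smulRight (c k)) y := fun k y _ =>
    (phase k).hasFDerivAt.cexp.smul_const (c k)
  have hbound : ∀ k, ∀ y ∈ Metric.ball (0 : CSpace) R,
      ‖(Complex.exp (phase k y) • phase k).smulRight (c k)‖ ≤
        3 * A * Real.exp (-(1 * waveNorm k)) := by
    intro k y hy
    rw [mem_ball_zero_iff] at hy
    have hx := waveNorm_nonneg k
    have hA' := hA k
    set x := waveNorm k with hxd
    have h1 : ‖Complex.exp (phase k y)‖ ≤ Real.exp (3 * x * R) := by
      rw [Complex.norm_exp, Real.exp_le_exp]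
      refine (Complex.re_le_norm _).trans ((norm_phase_apply_le k y).trans ?_)
      gcongr
    have h2 : ‖phase k‖ ≤ 3 * x :=
      ContinuousLinearMap.opNorm_le_bound _ (by positivity) (norm_phase_apply_le k)
    have h3 : x ≤ Real.exp x := by linarith [Real.add_one_le_exp x]
    have h4 : Real.exp (3 * x * R) * Real.exp x * Real.exp (-((3 * R + 2) * x)) =
        Real.exp (-(1 * x)) := by
      rw [← Real.exp_add, ← Real.exp_add]; congr 1; ring
    rw [ContinuousLinearMap.norm_smulRight_apply, norm_smul]
    calc _ ≤ Real.exp (3 * x * R) * (3 * Real.exp x) *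
          (A * Real.exp (-((3 * R + 2) * x))) := by
          gcongr
          exact h2.trans (by gcongr)
      _ = 3 * A * (Real.exp (3 * x * R) * Real.exp x * Real.exp (-((3 * R + 2) * x))) := by ring
      _ = _ := by rw [h4]
  have h0 : Summable fun k => Complex.exp (phase k 0) • c k := by
    obtain ⟨A', hA'⟩ := hc 1
    refine Summable.of_norm_bounded ((summable_exp_neg_waveNorm one_pos).mul_left A') fun k => ?_
    simpa using hA' k
  exact (hasFDerivAt_tsum_of_isPreconnected
    ((summable_exp_neg_waveNorm one_pos).mul_left (3 * A)) Metric.isOpen_ball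
    (convex_ball _ _).isPreconnected hderiv hbound (Metric.mem_ball_self hR0) h0
    (by rw [mem_ball_zero_iff]; linarith)).differentiableAt

theorem exp_phase_complexify (k : Fin 3 → ℤ) (x : Space) :
    Complex.exp (phase k (complexify x)) = character k x := by
  rw [phase_apply, character, complexify]

theorem character_add_single (k : Fin 3 → ℤ) (x : Space) (i : Fin 3) :
    character k (x + EuclideanSpace.single i (2 * Real.pi)) = character k x := by
  have e : Complex.I * ∑ j, (k j : ℂ) *
      (((x + EuclideanSpace.single i (2 * Real.pi)) j : ℝ) : ℂ) =
      Complex.I * ∑ j, (k j : ℂ) * (x j : ℂ) + k i * (2 * Real.pi * Complex.I) := by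
    simp only [PiLp.add_apply, Complex.ofReal_add, mul_add, Finset.sum_add_distrib]
    congr 1
    rw [Finset.sum_eq_single i]
    · simp; ring
    · intro j _ hj; simp [hj]
    · simp
  rw [character, e, Complex.exp_add, Complex.exp_int_mul_two_pi_mul_I, mul_one, character]

theorem complexSeries_complexify_add_single (c : CoeffSeq) (x : Space) (i : Fin 3) :
    complexSeries c (complexify (x + EuclideanSpace.single i (2 * Real.pi))) =
      complexSeries c (complexify x) := by
  simp only [complexSeries, exp_phase_complexify, character_add_single]

theorem measurableSet_cell : MeasurableSet cell := by
  have : cell = ⋂ i, {x : Space | x i ∈ Set.Icc (0 : ℝ) (2 * Real.pi)} := by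
    ext x; simp [cell]
  rw [this]
  exact MeasurableSet.iInter fun i =>
    (isClosed_Icc.preimage (by fun_prop : Continuous fun x : Space => x i)).measurableSet

/-- A periodic property which holds almost everywhere on the cell holds almost everywhere. -/
theorem ae_of_ae_cell {P : Space → Prop}
    (hP : ∀ x i, P (x + EuclideanSpace.single i (2 * Real.pi)) ↔ P x)
    (h : ∀ᵐ x ∂cellMeasure, P x) : ∀ᵐ x : Space, P x := by
  -- The periods of `P` form a group, so the three generators yield all lattice translations; these
  -- are countably many, so their exceptional sets have a null union.
  let G : AddSubgroup Space :=
    { carrier := {v | ∀ x, P (x + v) ↔ P x}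
      add_mem' := fun {v w} hv hw x => by rw [← add_assoc, hw, hv]
      zero_mem' := fun x => by rw [add_zero]
      neg_mem' := fun {v} hv x => by rw [← hv (x + -v), neg_add_cancel_right] }
  let shift : (Fin 3 → ℤ) → Space := fun m =>
    ∑ i, m i • EuclideanSpace.single i (2 * Real.pi)
  have hG : ∀ m, shift m ∈ G := fun m =>
    sum_mem fun i _ => zsmul_mem (show EuclideanSpace.single i (2 * Real.pi) ∈ G from
      fun x => hP x i) _
  have hshift : ∀ m i, shift m i = m i * (2 * Real.pi) := fun m i => by
    simp only [shift, WithLp.ofLp_sum, Finset.sum_apply, PiLp.smul_apply]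
    rw [Finset.sum_eq_single i]
    · simp
    · intro j _ hj; simp [hj.symm]
    · simp
  rw [cellMeasure, ae_restrict_iff' measurableSet_cell] at h
  have h' : ∀ᵐ x : Space, ∀ m : Fin 3 → ℤ, x - shift m ∈ cell → P (x - shift m) := by
    rw [ae_all_iff]
    intro m
    exact (measurePreserving_sub_right volume (shift m)).quasiMeasurePreserving.ae h
  filter_upwards [h'] with x hx
  have h2pi : 0 < 2 * Real.pi := by positivity
  set m : Fin 3 → ℤ := fun i => ⌊x i / (2 * Real.pi)⌋ with hm
  have hc : x - shift m ∈ cell := fun i => by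
    rw [PiLp.sub_apply, hshift]
    have h1 := Int.floor_le (x i / (2 * Real.pi))
    have h2 := (Int.lt_floor_add_one (x i / (2 * Real.pi))).le
    rw [le_div_iff₀ h2pi] at h1
    rw [div_le_iff₀ h2pi] at h2
    constructor <;> simp only [hm] <;> linarith
  have := (hG m (x - shift m)).mpr (hx m hc)
  rwa [sub_add_cancel] at this

/-- A square-integrable function is the sum of its Fourier series if that converges absolutely. -/
theorem ae_eq_tsum_of_summable {f : Space → ℂ} (hf : MemLp f 2 meanMeasure)
    (hs : Summable fun k => ‖cCoeff f k‖)
    (hcont : Continuous fun x => ∑' k, character k x * cCoeff f k) :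
    f =ᵐ[meanMeasure] fun x => ∑' k, character k x * cCoeff f k := by
  have hf' := hf.comp_measurePreserving measurePreserving_cellMap
  have hL2 := UnitAddTorus.hasSum_mFourier_series_L2 (d := Fin 3) hf'.toLp
  have hco : ∀ k, UnitAddTorus.mFourierCoeff hf'.toLp k = cCoeff f k := fun k => by
    rw [← mFourierCoeff_comp_cellMap hf.1]
    refine integral_congr_ae ?_
    filter_upwards [hf'.coeFn_toLp] with y hy
    rw [hy]
  simp only [hco] at hL2
  have hsC : Summable fun k => cCoeff f k • (UnitAddTorus.mFourier k : C(UnitAddTorus (Fin 3), ℂ)) :=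
    Summable.of_norm (by simpa only [norm_smul, UnitAddTorus.mFourier_norm, mul_one] using hs)
  set g := ∑' k, cCoeff f k • (UnitAddTorus.mFourier k : C(UnitAddTorus (Fin 3), ℂ)) with hg
  have hgL := hsC.hasSum.mapL (ContinuousMap.toLp (E := ℂ) 2 volume ℂ)
  simp only [map_smul] at hgL
  have heq := hL2.unique hgL
  have hgy : ∀ y, g y = ∑' k, character k (cellMap y) * cCoeff f k := fun y => by
    rw [hg, ← ContinuousMap.tsum_apply hsC]
    refine tsum_congr fun k => ?_
    rw [ContinuousMap.smul_apply, mFourier_eq_character, smul_eq_mul, mul_comm]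
  have hae : (f - fun x => ∑' k, character k x * cCoeff f k) ∘ cellMap =ᵐ[volume] 0 := by
    have h1 := hf'.coeFn_toLp
    rw [heq] at h1
    filter_upwards [h1, ContinuousMap.coeFn_toLp (p := 2) (𝕜 := ℂ) volume g] with y h2 h3
    rw [h3, hgy] at h2
    simp only [Function.comp_apply, Pi.sub_apply, Pi.zero_apply] at h2 ⊢
    rw [← h2, sub_self]
  -- Equality on the torus is carried back to the cell through the `L²` norm of the difference,
  -- which the measure-preserving parametrization preserves.
  have hm := hf.1.sub hcont.aestronglyMeasurable
  have hz := (eLpNorm_congr_ae (p := 2) hae).trans eLpNorm_zero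
  rw [eLpNorm_comp_measurePreserving hm measurePreserving_cellMap,
    eLpNorm_eq_zero_iff hm two_ne_zero] at hz
  filter_upwards [hz] with x hx
  exact sub_eq_zero.mp hx

theorem isEntire_of_norm_fieldCoeff_le {φ : Space → Space} (h : MemH φ)
    (hc : ∀ γ, ∃ A, ∀ k, ‖fieldCoeff φ k‖ ≤ A * Real.exp (-(γ * waveNorm k))) : IsEntire φ := by
  have hd := differentiable_complexSeries hc
  refine ⟨complexSeries (fieldCoeff φ), hd, ?_⟩
  have hcompl : Continuous complexify := by
    unfold complexify; fun_prop
  obtain ⟨A, hA⟩ := hc 1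
  have hS := (summable_exp_neg_waveNorm one_pos).mul_left A
  have hsum : ∀ x, Summable fun k => character k x • fieldCoeff φ k := fun x =>
    Summable.of_norm_bounded hS fun k => by
      rw [norm_smul, norm_character, one_mul]; exact hA k
  have hcomp : ∀ x i, complexSeries (fieldCoeff φ) (complexify x) i =
      ∑' k, character k x * cCoeff (fun x => ((φ x i : ℝ) : ℂ)) k := fun x i => by
    simp only [complexSeries, exp_phase_complexify]
    have := (EuclideanSpace.proj (𝕜 := ℂ) i).map_tsum (hsum x)
    simpa [fieldCoeff, coeff_eq_cCoeff] using this
  refine ae_of_ae_cell (fun x i => ?_) ?_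
  · rw [complexSeries_complexify_add_single, complexify, h.periodic, ← complexify]
  · have hmean : ∀ᵐ x ∂meanMeasure, ∀ i, ((φ x i : ℝ) : ℂ) =
        complexSeries (fieldCoeff φ) (complexify x) i := by
      rw [ae_all_iff]
      intro i
      have hci : Continuous fun x =>
          ∑' k, character k x * cCoeff (fun x => ((φ x i : ℝ) : ℂ)) k := by
        simp only [← hcomp]
        exact (EuclideanSpace.proj (𝕜 := ℂ) i).continuous.comp (hd.continuous.comp hcompl)
      have := ae_eq_tsum_of_summable (memLp_ofReal_component h.memLp i)
        (Summable.of_nonneg_of_le (fun _ => norm_nonneg _) (fun k => by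
          rw [← coeff_eq_cCoeff]
          exact (norm_component_le (fieldCoeff φ k) i).trans (hA k)) hS) hci
      filter_upwards [this] with x hx
      rw [hx, hcomp]
    rw [meanMeasure, Measure.ae_ennreal_smul_measure_iff (by
      rw [ne_eq, ENNReal.ofReal_eq_zero, not_le]; positivity)] at hmean
    filter_upwards [hmean] with x hx
    ext i
    exact (hx i).symm

end ExpNSE

end

/-! ### Assembly of the three claims -/

theorem corollary3p1 (μ σ : ℝ) (hμ : 0 < μ) (hσ : 0 < σ) :
    -- for positive times the solution is entire in space
    (∀ (u₀ : ExpNSE.Space → ExpNSE.Space) (u : ℝ → ExpNSE.Space → ExpNSE.Space),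
      ExpNSE.MemH u₀ → ExpNSE.IsSolution μ σ u₀ u →
        ∀ t : ℝ, 0 < t → ExpNSE.IsEntire (u t)) ∧
    -- the explicit bound on the Fourier coefficients
    (∀ κ δ L U M : ℝ, 3 < κ → 0 < δ → 0 < L → 0 < U → 0 < M →
      ∃ Λ : ℝ, 0 < Λ ∧
        ∀ (u₀ : ExpNSE.Space → ExpNSE.Space) (u : ℝ → ExpNSE.Space → ExpNSE.Space),
          ExpNSE.MemH u₀ →
          MeasureTheory.eLpNorm u₀ 2 ExpNSE.cellMeasure ≤ ENNReal.ofReal M →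
          ExpNSE.IsSolution μ σ u₀ u →
          ∀ t : ℝ, 0 < t → ∀ ε : ℝ, 0 < ε → ε < 1 → ∀ k : Fin 3 → ℤ,
            Real.sqrt (Λ * L / (U * t)) ^ (ExpNSE.beta κ δ / (ε * σ)) ≤ ExpNSE.waveNorm k →
            ‖ExpNSE.fieldCoeff (u t) k‖ ≤
              Real.exp (-(σ * (1 - ε) / ExpNSE.beta κ δ) *
                (ExpNSE.waveNorm k * Real.log (ExpNSE.waveNorm k)))) ∧
    -- decay faster than `e^{-C k̃ ln k̃}`, where `k̃ = 2σ|k|`, for every `C < 1/(2 ln 2)`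
    (∀ (u₀ : ExpNSE.Space → ExpNSE.Space) (u : ℝ → ExpNSE.Space → ExpNSE.Space),
      ExpNSE.MemH u₀ → ExpNSE.IsSolution μ σ u₀ u →
        ∀ t : ℝ, 0 < t → ∀ C : ℝ, C < 1 / (2 * Real.log 2) →
          (fun k : Fin 3 → ℤ => ExpNSE.fieldCoeff (u t) k) =o[Filter.cofinite]
            (fun k : Fin 3 → ℤ => Real.exp (-C * ((2 * σ * ExpNSE.waveNorm k) *
              Real.log (2 * σ * ExpNSE.waveNorm k))))) := by
  refine ⟨fun u₀ u hu₀ hu t ht => ?_, fun κ δ L U M hκ hδ hL hU hM => ?_,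
    fun u₀ u hu₀ hu t ht C hC => ?_⟩
  -- No bound on the data is prescribed here, so the norm of `u₀` itself serves as `M`.
  · have h := hu.isCoeffSolution ENNReal.toReal_nonneg
      (ENNReal.ofReal_toReal hu₀.memLp.eLpNorm_ne_top).ge
    exact ExpNSE.isEntire_of_norm_fieldCoeff_le (hu.memH t ht.le)
      (h.exists_norm_le_exp hμ hσ ht)
  · obtain ⟨N, hN, h⟩ := ExpNSE.exists_norm_le_of_threshold hμ hσ hM.le
      (ExpNSE.log_two_lt_beta hκ hδ)
    -- This choice of `Λ` makes `ΛL/(Ut)` equal to `N/t`.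
    refine ⟨N * U / L, by positivity, fun u₀ u _ hu₀M hu t ht ε hε hε1 k hk => ?_⟩
    refine h _ (hu.isCoeffSolution hM.le hu₀M) t ht ε hε hε1 k ?_
    convert hk using 3
    field_simp
  · have h := hu.isCoeffSolution ENNReal.toReal_nonneg
      (ENNReal.ofReal_toReal hu₀.memLp.eLpNorm_ne_top).ge
    exact h.isLittleO hμ hσ ENNReal.toReal_nonneg ht hC
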